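/- **Theorem 1.1 (Main Theorem).** Let $S_n$ be the set of permutations $\pi=\pi_1\cdots\pi_n$ of $\{1,\ldots,n\}$. A *run* of $\pi$ is a maximal consecutive increasing subsequence of $\pi$, and $\mathsf{runsort}(\pi)\in S_n$ is obtained from $\pi$ by sorting its runs so that their smallest entries appear in increasing order (equivalently, sorting the runs lexicographically). For $\sigma\in S_n$, let $\gamma_\sigma$ be the measure on $[0,1]^2$ with density $n$ on $\bigcup_{i=1}^n\left[\frac{i-1}n,\frac in\right)\times\left[\frac{\sigma_i-1}n,\frac{\sigma_i}n\right)$ and density $0$ elsewhere. For measures $\gamma_1,\gamma_2$ on $[0,1]^2$, let $d_\square(\gamma_1,\gamma_2)=\sup_B|\gamma_1(B)-\gamma_2(B)|$, where $B$ ranges over the axis-parallel rectangles $[x_1,x_2]\times[y_1,y_2]\subseteq[0,1]^2$. Let $\mathbf R$ be the measure on $[0,1]^2$ given for measurable $B\subseteq[0,1]^2$ by $$\mathbf R(B)=\int_{B\cap\mathcal C^+}e^{y-1}\,dx\,dy+\int_{\{y\in[0,1]:\,(ye^{1-y},\,y)\in B\}}(1-y)\,dy,\qquad \mathcal C^+=\{(x,y)\in[0,1]^2:x<ye^{1-y}\};$$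 that is, $\mathbf R$ has density $e^{y-1}$ on the region above the curve $\mathcal C=\{(x,y)\in[0,1]^2:x=ye^{1-y}\}$, plus singular mass $(1-y)\,dy$ on $\mathcal C$. Let $\pi^{(n)}$ be chosen uniformly at random from $S_n$. Then for every $\varepsilon>0$, $$\Pr\left[d_\square\left(\gamma_{\mathsf{runsort}(\pi^{(n)})},\mathbf R\right)<\varepsilon\right]\longrightarrow 1\qquad(n\to\infty).$$ Moreover, $\mathbf R$ is a permuton, i.e. a probability measure on $[0,1]^2$ with uniform marginals, $\mathbf R([a,b]\times[0,1])=\mathbf R([0,1]\times[a,b])=b-a$ for all $0\le a\le b\le1$, and its support is $\{(x,y)\in[0,1]^2:x\le ye^{1-y}\}$. -/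

import Mathlib

open MeasureTheory Set Filter Topology

/-- The positions `j` lying in the same ascending run of `π` as the position `i`: the entries of `π`
increase along all consecutive positions between `i` and `j`. -/
def run {n : ℕ} (π : Equiv.Perm (Fin n)) (i : Fin n) : Finset (Fin n) :=
  {j | ∀ k l : Fin n, min i j ≤ k → k < l → l ≤ max i j → π k < π l}

theorem mem_run_self {n : ℕ} (π : Equiv.Perm (Fin n)) (i : Fin n) : i ∈ run π i := by
  simp only [run, Finset.mem_filter, Finset.mem_univ, true_and, min_self, max_self]
  intro k l hk hkl hl
  exact absurd (hk.trans_lt (hkl.trans_le hl)) (lt_irrefl _)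

/-- The smallest entry of the ascending run of `π` containing the position `i`. -/
def runMin {n : ℕ} (π : Equiv.Perm (Fin n)) (i : Fin n) : Fin n :=
  (run π i).inf' ⟨i, mem_run_self π i⟩ π

/-- `runsort π` sorts the ascending runs of `π` so that their smallest entries increase, keeping
the order inside each run (`Tuple.sort` is the stable sort: positions with the same key keep
their order). The entry of `runsort π` in position `k` is `π (Tuple.sort (runMin π) k)`. -/
def runsort {n : ℕ} (π : Equiv.Perm (Fin n)) : Equiv.Perm (Fin n) :=
  π * Tuple.sort (runMin π)

/-- The grid square of side `1/n` whose upper right corner is the point of the scaled plot of `σ`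
belonging to position `i`. Positions and entries are numbered from `0`. -/
def plotCell {n : ℕ} (σ : Equiv.Perm (Fin n)) (i : Fin n) : Set (ℝ × ℝ) :=
  Ico ((i : ℝ) / n) (((i : ℝ) + 1) / n) ×ˢ Ico (((σ i : ℕ) : ℝ) / n) ((((σ i : ℕ) : ℝ) + 1) / n)

/-- The measure of a permutation `σ` of size `n`: density `n` on the squares of its scaled plot,
and density `0` elsewhere. -/
noncomputable def permMeasure {n : ℕ} (σ : Equiv.Perm (Fin n)) : Measure (ℝ × ℝ) :=
  (volume.restrict (⋃ i, plotCell σ i)).withDensity (fun _ => (n : ENNReal))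

/-- The distance `d_□`: the supremum of `|γ₁ B - γ₂ B|` over the axis-parallel rectangles `B`
in the unit square. The set of values is bounded when both measures are finite. -/
noncomputable def rectDist (γ₁ γ₂ : Measure (ℝ × ℝ)) : ℝ :=
  sSup {r : ℝ | ∃ x₁ x₂ y₁ y₂ : ℝ, 0 ≤ x₁ ∧ x₁ ≤ x₂ ∧ x₂ ≤ 1 ∧ 0 ≤ y₁ ∧ y₁ ≤ y₂ ∧ y₂ ≤ 1 ∧
    r = |γ₁.real (Icc x₁ x₂ ×ˢ Icc y₁ y₂) - γ₂.real (Icc x₁ x₂ ×ˢ Icc y₁ y₂)|}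

/-- A permuton: a probability measure carried by the unit square, with uniform marginals. -/
structure IsPermuton (γ : Measure (ℝ × ℝ)) : Prop where
  isProbabilityMeasure : IsProbabilityMeasure γ
  outside : γ (Icc (0 : ℝ) 1 ×ˢ Icc (0 : ℝ) 1)ᶜ = 0
  marginal_fst : ∀ a b : ℝ, 0 ≤ a → a ≤ b → b ≤ 1 →
    γ (Icc a b ×ˢ Icc (0 : ℝ) 1) = ENNReal.ofReal (b - a)
  marginal_snd : ∀ a b : ℝ, 0 ≤ a → a ≤ b → b ≤ 1 →
    γ (Icc (0 : ℝ) 1 ×ˢ Icc a b) = ENNReal.ofReal (b - a)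

/-- The region of the unit square above the curve `x = y e ^ (1 - y)`. -/
def aboveCurve : Set (ℝ × ℝ) :=
  {p | p ∈ Icc (0 : ℝ) 1 ×ˢ Icc (0 : ℝ) 1 ∧ p.1 < p.2 * Real.exp (1 - p.2)}

/-- The runsort permuton: density `e ^ (y - 1)` on the region above the curve
`x = y e ^ (1 - y)`, plus the mass `(1 - y) dy` on the curve, parametrized by `y ∈ [0, 1]`. -/
noncomputable def runsortPermuton : Measure (ℝ × ℝ) :=
  (volume.restrict aboveCurve).withDensity (fun p => ENNReal.ofReal (Real.exp (p.2 - 1))) +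
  ((volume.restrict (Icc (0 : ℝ) 1)).withDensity (fun y => ENNReal.ofReal (1 - y))).map
    (fun y : ℝ => (y * Real.exp (1 - y), y))

/-! Sorting the runs by their minima places all runs with minimum below `s * n` in an initial block
of positions. So the distribution function of the plot of `runsort π` at the end of this block is a
statistic of `π` itself: the number of entries below `y * n` lying in runs with minimum below `s *
n` (`lowRunCount`, linked by `card_lt_lowRunCount_and_runsort_lt`).

To compute it for `s ≤ y`, walk left from such an entry along its run until the first entry below `s
* n`. If this takes `k` steps, the last `k + 1` entries form an increasing tuple that starts below
`s * n` and then stays in `[s * n, y * n)`. Such tuples have asymptotic frequency `s * (y - s) ^ k /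
k!`, and a second moment bound gives concentration (`tendstoInMean_windowCount`). Summing over `k`
yields `s * exp (y - s)`. At `y = 1` this is `curve s`, the asymptotic length of the block, which is
where the limiting curve comes from.

The same value is the mass that the limit gives to `[0, curve s] × [0, y]` (`runsortPermuton_box`).
Uniform marginals make all distribution functions involved Lipschitz, so convergence on a finite
grid controls every rectangle (`rectDist_le`). Markov's inequality turns convergence of the mean
distance into convergence in probability. -/

open scoped BigOperators

/-! ### Counting permutations by their values at prescribed positions. -/

theorem card_perm_comp_embedding {α β : Type*} [Fintype α] [Fintype β] [DecidableEq α]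
    [DecidableEq β] (e : α ↪ β) (S : Finset (α ↪ β)) :
    Finset.card {π : Equiv.Perm β | e.trans π.toEmbedding ∈ S} * Fintype.card (α ↪ β) =
      S.card * Fintype.card (Equiv.Perm β) := by
  classical
  set fib : (α ↪ β) → Finset (Equiv.Perm β) := fun w => {π | e.trans π.toEmbedding = w} with hfib
  have hle : ∀ w w', (fib w).card ≤ (fib w').card := by
    intro w w'
    -- Left multiplication by a permutation carrying `w` to `w'` injects one fibre into the other,
    -- so all fibres have equal size.
    obtain ⟨g, hg⟩ := Equiv.Perm.exists_extending_pair w w' w.injective w'.injective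
    refine Finset.card_le_card_of_injOn (fun π => g * π) ?_ (fun a _ b _ h => mul_left_cancel h)
    intro π hπ
    simp only [hfib, Finset.coe_filter, Finset.mem_univ, true_and, mem_ofPred_eq] at hπ ⊢
    subst hπ
    ext x
    simpa using hg x
  have hS : ∀ T : Finset (α ↪ β), Finset.card {π : Equiv.Perm β | e.trans π.toEmbedding ∈ T} =
      T.card * (fib e).card := by
    intro T
    rw [Finset.card_eq_sum_card_fiberwise (f := fun π : Equiv.Perm β => e.trans π.toEmbedding)
      (t := T) (fun π hπ => by simpa using hπ)]
    rw [Finset.sum_const_nat (m := (fib e).card)]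
    intro w hw
    rw [← le_antisymm (hle w e) (hle e w)]
    congr 1
    ext π
    simp only [hfib, Finset.mem_filter, Finset.mem_univ, true_and]
    exact ⟨fun h => h.2, fun h => ⟨h ▸ hw, h⟩⟩
  have h1 := hS S
  have h2 := hS Finset.univ
  simp only [Finset.mem_univ, Finset.filter_true, Finset.card_univ] at h2
  rw [h1, h2]
  ring

/-! ### Window counts and their second moment. -/

/-- The `k + 1` positions ending at position `i`; positions before the first are replaced by it. -/
def window {n : ℕ} (k : ℕ) (i : Fin n) (j : Fin (k + 1)) : Fin n := ⟨i - (k - j), by omega⟩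

theorem window_injective {n k : ℕ} {i : Fin n} (hi : k ≤ i) :
    Function.Injective (window k i) := by
  intro a b h
  simp only [window, Fin.mk.injEq] at h
  omega

/-- The number of positions at which a window of `π` with entries in `B` ends. -/
def windowCount {n k : ℕ} (B : Finset (Fin (k + 1) → Fin n)) (π : Equiv.Perm (Fin n)) : ℕ :=
  Finset.card {i : Fin n | (π ∘ window k i) ∈ B}

/-- A window truncated at the left end repeats the position `0`, so its entries cannot form an
injective tuple. Truncated windows are therefore never counted. -/
theorem le_of_comp_window_mem {n k : ℕ} {B : Finset (Fin (k + 1) → Fin n)}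
    (hB : ∀ w ∈ B, Function.Injective w) {π : Equiv.Perm (Fin n)} {i : Fin n}
    (h : (π ∘ window k i) ∈ B) : k ≤ i := by
  by_contra hlt
  have hinj := (hB _ h).of_comp
  have h01 : window k i 0 = window k i ⟨k - i, by omega⟩ := by
    simp only [window, Fin.mk.injEq, Fin.val_zero]
    omega
  have := congrArg Fin.val (hinj h01)
  simp at this
  omega

theorem card_comp_window_mem {n k : ℕ} {B : Finset (Fin (k + 1) → Fin n)}
    (hB : ∀ w ∈ B, Function.Injective w) {i : Fin n} (hi : k ≤ i) :
    Finset.card {π : Equiv.Perm (Fin n) | (π ∘ window k i) ∈ B} * n.descFactorial (k + 1) =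
      B.card * n.factorial := by
  classical
  have h := card_perm_comp_embedding (⟨window k i, window_injective hi⟩ : Fin (k + 1) ↪ Fin n)
    (Finset.univ.filter fun w => (w : Fin (k + 1) → Fin n) ∈ B)
  have hc : Finset.card (Finset.univ.filter
      fun w : Fin (k + 1) ↪ Fin n => (w : Fin (k + 1) → Fin n) ∈ B) = B.card :=
    Finset.card_bij' (fun w _ => w) (fun w hw => ⟨w, hB w hw⟩) (by simp) (by simp) (by simp)
      (by simp)
  rw [hc, Fintype.card_embedding_eq, Fintype.card_perm, Fintype.card_fin, Fintype.card_fin] at h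
  rw [← h]
  congr 2
  ext π
  simp only [Finset.mem_filter, Finset.mem_univ, true_and]
  rfl

/-- Disjoint windows read off a single embedding of `2 * (k + 1)` positions. Only an inequality
holds, because two tuples of `B` sharing a value do not combine into an embedding. -/
theorem card_comp_two_windows_mem_le {n k : ℕ} {B : Finset (Fin (k + 1) → Fin n)}
    {i j : Fin n} (hi : k ≤ i) (hij : (i : ℕ) + k < j) :
    Finset.card {π : Equiv.Perm (Fin n) | (π ∘ window k i) ∈ B ∧ (π ∘ window k j) ∈ B} *
      n.descFactorial (2 * (k + 1)) ≤ B.card ^ 2 * n.factorial := by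
  classical
  have hinj : Function.Injective (Sum.elim (window k i) (window k j)) := by
    refine (window_injective hi).sumElim (window_injective (by omega)) ?_
    intro a b h
    simp only [window, Fin.mk.injEq] at h
    omega
  set S : Finset (Fin (k + 1) ⊕ Fin (k + 1) ↪ Fin n) := Finset.univ.filter
    fun w => (w ∘ Sum.inl) ∈ B ∧ (w ∘ Sum.inr) ∈ B with hS
  have h := card_perm_comp_embedding (⟨_, hinj⟩ : Fin (k + 1) ⊕ Fin (k + 1) ↪ Fin n) S
  have hc : S.card ≤ B.card ^ 2 := by
    rw [sq, ← Finset.card_product]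
    refine Finset.card_le_card_of_injOn (fun w => (w ∘ Sum.inl, w ∘ Sum.inr)) ?_ ?_
    · intro w hw
      simpa [hS] using hw
    · intro w _ w' _ hww
      simp only [Prod.mk.injEq] at hww
      ext x
      rcases x with x | x
      · exact congrArg Fin.val (congrFun hww.1 x)
      · exact congrArg Fin.val (congrFun hww.2 x)
  rw [Fintype.card_embedding_eq, Fintype.card_perm, Fintype.card_sum, Fintype.card_fin,
    Fintype.card_fin, ← two_mul] at h
  refine le_trans (le_of_eq ?_) (Nat.mul_le_mul_right _ hc)
  rw [← h]
  congr 2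
  ext π
  simp only [hS, Finset.mem_filter, Finset.mem_univ, true_and]
  rfl

/-- Convergence in mean of functions of a uniformly random permutation to a constant. -/
def TendstoInMean (X : ∀ n : ℕ, Equiv.Perm (Fin n) → ℝ) (c : ℝ) : Prop :=
  Tendsto (fun n => 𝔼 π, |X n π - c|) atTop (𝓝 0)

/-- By Cauchy–Schwarz, the mean absolute deviation is at most the root of the mean square deviation.
-/
theorem TendstoInMean.of_sq {X : ∀ n : ℕ, Equiv.Perm (Fin n) → ℝ} {c : ℝ}
    (h : Tendsto (fun n => 𝔼 π, (X n π - c) ^ 2) atTop (𝓝 0)) : TendstoInMean X c := by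
  have h2 : Tendsto (fun n => √(𝔼 π, (X n π - c) ^ 2)) atTop (𝓝 0) := by
    simpa using h.sqrt
  refine squeeze_zero (fun n => Finset.expect_nonneg fun π _ => abs_nonneg _) (fun n => ?_) h2
  apply Real.le_sqrt_of_sq_le
  simp only [Fintype.expect_eq_sum_div_card]
  have hc : (0 : ℝ) < (Fintype.card (Equiv.Perm (Fin n)) : ℝ) := by positivity
  have := sq_sum_le_card_mul_sum_sq (s := Finset.univ) (f := fun π => |X n π - c|)
  simp only [sq_abs, Finset.card_univ] at this
  rw [div_pow, div_le_div_iff₀ (by positivity) hc]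
  nlinarith

theorem tendsto_descFactorial_div_pow {L : ℕ → ℕ} {l : ℝ}
    (h : Tendsto (fun n => (L n : ℝ) / n) atTop (𝓝 l)) (k : ℕ) :
    Tendsto (fun n => ((L n).descFactorial k : ℝ) / (n : ℝ) ^ k) atTop (𝓝 (l ^ k)) := by
  induction k with
  | zero => simp
  | succ k ih =>
    have h1 : Tendsto (fun n => ((L n - k : ℕ) : ℝ) / n) atTop (𝓝 l) := by
      refine tendsto_of_tendsto_of_tendsto_of_le_of_le (g := fun n => (L n : ℝ) / n - k / n)
        (h := fun n => (L n : ℝ) / n) ?_ h ?_ ?_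
      · simpa using h.sub (tendsto_const_div_atTop_nhds_zero_nat (k : ℝ))
      · intro n
        simp only [← sub_div]
        gcongr
        have : L n ≤ (L n - k) + k := by omega
        have : (L n : ℝ) ≤ ((L n - k : ℕ) : ℝ) + k := by exact_mod_cast this
        linarith
      · intro n
        simp only
        gcongr
        omega
    rw [pow_succ']
    refine (h1.mul ih).congr fun n => ?_
    rw [Nat.descFactorial_succ, Nat.cast_mul, pow_succ']
    ring

theorem expect_perm_ite {n : ℕ} (p : Equiv.Perm (Fin n) → Prop) [DecidablePred p] :
    (𝔼 π, if p π then (1 : ℝ) else 0) = (Finset.card {π | p π} : ℝ) / n.factorial := by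
  rw [Fintype.expect_eq_sum_div_card, Fintype.card_perm, Fintype.card_fin, Finset.sum_boole]

theorem windowCount_eq_sum {n k : ℕ} (B : Finset (Fin (k + 1) → Fin n)) (π : Equiv.Perm (Fin n)) :
    (windowCount B π : ℝ) = ∑ i, if (π ∘ window k i) ∈ B then (1 : ℝ) else 0 := by
  rw [Finset.sum_boole, windowCount]

theorem le_expect_windowCount {n k : ℕ} {B : Finset (Fin (k + 1) → Fin n)}
    (hB : ∀ w ∈ B, Function.Injective w) (hn : k + 1 ≤ n) :
    ((n - k : ℕ) : ℝ) * (B.card / n.descFactorial (k + 1)) ≤ 𝔼 π, (windowCount B π : ℝ) := by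
  simp only [windowCount_eq_sum]
  rw [Finset.expect_sum_comm]
  have hd : (0 : ℝ) < n.descFactorial (k + 1) := by
    exact_mod_cast Nat.descFactorial_pos.2 hn
  calc ((n - k : ℕ) : ℝ) * (B.card / n.descFactorial (k + 1))
      = ∑ i ∈ Finset.Ici (⟨k, hn⟩ : Fin n), (B.card / n.descFactorial (k + 1) : ℝ) := by
        rw [Finset.sum_const, nsmul_eq_mul, Fin.card_Ici]
    _ ≤ ∑ i ∈ Finset.Ici (⟨k, hn⟩ : Fin n), 𝔼 π : Equiv.Perm (Fin n),
          (if (π ∘ window k i) ∈ B then (1 : ℝ) else 0) := by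
        refine Finset.sum_le_sum fun i hi => ?_
        rw [expect_perm_ite, div_le_div_iff₀ hd (by positivity)]
        have := card_comp_window_mem hB (i := i) (Fin.le_def.1 (Finset.mem_Ici.1 hi))
        exact_mod_cast this.ge
    _ ≤ _ := Finset.sum_le_sum_of_subset_of_nonneg (Finset.subset_univ _)
        fun i _ _ => Finset.expect_nonneg fun π _ => by positivity

/-- Expand the square over pairs of windows. Disjoint pairs are nearly independent; each position
has at most `2 * k + 1` overlapping partners, which contribute only linearly in `n`. -/
theorem expect_windowCount_sq_le {n k : ℕ} {B : Finset (Fin (k + 1) → Fin n)}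
    (hB : ∀ w ∈ B, Function.Injective w) (hn : 2 * (k + 1) ≤ n) :
    𝔼 π, (windowCount B π : ℝ) ^ 2 ≤
      (n : ℝ) ^ 2 * ((B.card : ℝ) ^ 2 / n.descFactorial (2 * (k + 1))) + n * (2 * k + 1) := by
  have hd : (0 : ℝ) < n.descFactorial (2 * (k + 1)) := by
    exact_mod_cast Nat.descFactorial_pos.2 hn
  set q : ℝ := (B.card : ℝ) ^ 2 / n.descFactorial (2 * (k + 1)) with hq
  have hq0 : 0 ≤ q := by positivity
  have hsq : ∀ π : Equiv.Perm (Fin n), (windowCount B π : ℝ) ^ 2 =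
      ∑ i, ∑ j, if (π ∘ window k i) ∈ B ∧ (π ∘ window k j) ∈ B then (1 : ℝ) else 0 := by
    intro π
    rw [windowCount_eq_sum, sq, Finset.sum_mul_sum]
    refine Finset.sum_congr rfl fun i _ => Finset.sum_congr rfl fun j _ => ?_
    by_cases h1 : (π ∘ window k i) ∈ B <;> by_cases h2 : (π ∘ window k j) ∈ B <;> simp [h1, h2]
  have hfar : ∀ i j : Fin n, (i : ℕ) + k < j → (𝔼 π : Equiv.Perm (Fin n),
      if (π ∘ window k i) ∈ B ∧ (π ∘ window k j) ∈ B then (1 : ℝ) else 0) ≤ q := by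
    intro i j hij
    rw [expect_perm_ite]
    by_cases hi : k ≤ i
    · rw [hq, div_le_div_iff₀ (by positivity) hd]
      exact_mod_cast card_comp_two_windows_mem_le hi hij
    · rw [Finset.card_eq_zero.2]
      · simpa using hq0
      · exact Finset.filter_eq_empty_iff.2 fun π _ h => hi (le_of_comp_window_mem hB h.1)
  have hpair : ∀ i j : Fin n, (𝔼 π : Equiv.Perm (Fin n),
      if (π ∘ window k i) ∈ B ∧ (π ∘ window k j) ∈ B then (1 : ℝ) else 0) ≤
      q + if (i : ℕ) ≤ j + k ∧ (j : ℕ) ≤ i + k then 1 else 0 := by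
    intro i j
    split_ifs with h
    · refine le_trans (Finset.expect_le_expect (g := fun _ => (1 : ℝ)) fun π _ => ?_) ?_
      · split_ifs <;> norm_num
      · rw [Fintype.expect_const]
        linarith
    · rw [add_zero]
      rcases Nat.lt_or_ge (i + k) j with h1 | h1
      · exact hfar i j h1
      · simp only [and_comm (a := (_ ∘ window k i) ∈ B)]
        exact hfar j i (by omega)
  simp only [hsq]
  rw [Finset.expect_sum_comm]
  simp only [Finset.expect_sum_comm]
  calc _ ≤ ∑ i : Fin n, ∑ j : Fin n,
        (q + if (i : ℕ) ≤ j + k ∧ (j : ℕ) ≤ i + k then (1 : ℝ) else 0) :=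
        Finset.sum_le_sum fun i _ => Finset.sum_le_sum fun j _ => hpair i j
    _ ≤ ∑ i : Fin n, (n * q + (2 * k + 1)) := by
        refine Finset.sum_le_sum fun i _ => ?_
        rw [Finset.sum_add_distrib, Finset.sum_const, Finset.sum_boole, Finset.card_univ,
          Fintype.card_fin, nsmul_eq_mul]
        gcongr
        have : Finset.card {j : Fin n | (i : ℕ) ≤ j + k ∧ (j : ℕ) ≤ i + k} ≤ 2 * k + 1 := by
          refine (Finset.card_le_card_of_injOn (t := Finset.Icc ((i : ℕ) - k) (i + k))
            Fin.val ?_ Fin.val_injective.injOn).trans ?_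
          · intro j hj
            simp only [Finset.coe_filter, Finset.mem_univ, true_and, mem_ofPred_eq] at hj
            simp only [Finset.coe_Icc, mem_Icc]
            omega
          · rw [Nat.card_Icc]
            omega
        exact_mod_cast this
    _ = _ := by
        rw [Finset.sum_const, Finset.card_univ, Fintype.card_fin, nsmul_eq_mul]
        ring

theorem tendstoInMean_windowCount {k : ℕ} {c : ℝ} (B : ∀ n : ℕ, Finset (Fin (k + 1) → Fin n))
    (hB : ∀ n, ∀ w ∈ B n, Function.Injective w)
    (hc : Tendsto (fun n => ((B n).card : ℝ) / (n : ℝ) ^ (k + 1)) atTop (𝓝 c)) :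
    TendstoInMean (fun n π => (windowCount (B n) π : ℝ) / n) c := by
  -- The mean enters the expanded square with factor `-2 * c`; since `c` is nonnegative, a lower
  -- bound for the mean suffices.
  have hc0 : 0 ≤ c := ge_of_tendsto' hc fun n => by positivity
  have hone : Tendsto (fun n : ℕ => (n : ℝ) / n) atTop (𝓝 1) := by
    refine tendsto_const_nhds.congr' ?_
    filter_upwards [eventually_gt_atTop 0] with n hn
    rw [div_self]
    positivity
  have hsub : Tendsto (fun n : ℕ => ((n - k : ℕ) : ℝ) / n) atTop (𝓝 1) := by
    have h := hone.sub (tendsto_const_div_atTop_nhds_zero_nat (k : ℝ))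
    rw [sub_zero] at h
    refine h.congr' ?_
    filter_upwards [eventually_ge_atTop k] with n hn
    rw [Nat.cast_sub hn]
    ring
  have hp : ∀ m, Tendsto (fun n : ℕ => (n.descFactorial m : ℝ) / (n : ℝ) ^ m) atTop (𝓝 1) := by
    intro m
    simpa using tendsto_descFactorial_div_pow (L := fun n => n) hone m
  have hlo : Tendsto (fun n : ℕ => ((n - k : ℕ) : ℝ) *
      ((B n).card / n.descFactorial (k + 1)) / n) atTop (𝓝 c) := by
    have h := hsub.mul (hc.div (hp (k + 1)) one_ne_zero)
    rw [div_one, one_mul] at h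
    refine h.congr' ?_
    filter_upwards [eventually_gt_atTop 0] with n hn
    have : (n : ℝ) ≠ 0 := by positivity
    rw [Pi.div_apply, div_div_div_cancel_right₀ (by positivity)]
    ring
  have hup : Tendsto (fun n : ℕ => ((n : ℝ) ^ 2 *
      (((B n).card : ℝ) ^ 2 / n.descFactorial (2 * (k + 1))) + n * (2 * k + 1)) / n ^ 2) atTop
      (𝓝 (c ^ 2)) := by
    have h := ((hc.pow 2).div (hp (2 * (k + 1))) one_ne_zero).add
      (tendsto_const_div_atTop_nhds_zero_nat (2 * k + 1 : ℝ))
    rw [div_one, add_zero] at h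
    refine h.congr' ?_
    filter_upwards [eventually_gt_atTop 0] with n hn
    have : (n : ℝ) ≠ 0 := by positivity
    rw [Pi.div_apply, div_pow, ← pow_mul, mul_comm (k + 1) 2,
      div_div_div_cancel_right₀ (by positivity)]
    field_simp
  refine TendstoInMean.of_sq ?_
  have h0 := (hup.sub (hlo.const_mul (2 * c))).add_const (c ^ 2)
  rw [show c ^ 2 - 2 * c * c + c ^ 2 = 0 by ring] at h0
  refine squeeze_zero' (Eventually.of_forall fun n => Finset.expect_nonneg fun π _ => sq_nonneg _)
    ?_ h0
  filter_upwards [eventually_ge_atTop (2 * (k + 1))] with n hn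
  have hn0 : (0 : ℝ) < n := by
    have : 0 < n := by omega
    exact_mod_cast this
  have hexp : (𝔼 π, ((windowCount (B n) π : ℝ) / n - c) ^ 2) =
      (𝔼 π, (windowCount (B n) π : ℝ) ^ 2) / n ^ 2 -
        2 * c * ((𝔼 π, (windowCount (B n) π : ℝ)) / n) + c ^ 2 := by
    have : ∀ π : Equiv.Perm (Fin n), ((windowCount (B n) π : ℝ) / n - c) ^ 2 =
        (windowCount (B n) π : ℝ) ^ 2 / n ^ 2 - 2 * c * ((windowCount (B n) π : ℝ) / n)
          + c ^ 2 := fun π => by ring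
    simp only [this]
    rw [Finset.expect_add_distrib, Finset.expect_sub_distrib, Fintype.expect_const,
      ← Finset.mul_expect, Finset.expect_div, Finset.expect_div]
  rw [hexp]
  have h1 := expect_windowCount_sq_le (hB n) hn
  have h2 := le_expect_windowCount (hB n) (by omega : k + 1 ≤ n)
  gcongr

/-! ### Low runs sandwiched between window counts. -/

/-- The increasing `k`-tuples with entries in `T`. -/
def increasingTuples {n : ℕ} (k : ℕ) (T : Finset (Fin n)) : Finset (Fin k → Fin n) :=
  {w | StrictMono w ∧ ∀ j, w j ∈ T}

theorem card_increasingTuples {n : ℕ} (k : ℕ) (T : Finset (Fin n)) :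
    (increasingTuples k T).card = T.card.choose k := by
  classical
  rw [← Finset.card_powersetCard]
  refine Finset.card_bij (fun w _ => Finset.univ.image w) ?_ ?_ ?_
  · intro w hw
    simp only [increasingTuples, Finset.mem_filter, Finset.mem_univ, true_and] at hw
    rw [Finset.mem_powersetCard, Finset.card_image_of_injective _ hw.1.injective]
    refine ⟨?_, by simp⟩
    intro x hx
    obtain ⟨j, -, rfl⟩ := Finset.mem_image.1 hx
    exact hw.2 j
  · intro w hw v hv h
    simp only [increasingTuples, Finset.mem_filter, Finset.mem_univ, true_and] at hw hv
    refine (StrictMono.range_inj hw.1 hv.1).1 ?_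
    simpa using congrArg (fun s : Finset (Fin n) => (s : Set (Fin n))) h
  · intro s hs
    rw [Finset.mem_powersetCard] at hs
    refine ⟨s.orderEmbOfFin hs.2, ?_, ?_⟩
    · simp only [increasingTuples, Finset.mem_filter, Finset.mem_univ, true_and]
      exact ⟨(s.orderEmbOfFin hs.2).strictMono, fun j => hs.1 (s.orderEmbOfFin_mem hs.2 j)⟩
    · rw [← Finset.coe_inj]
      simp

/-- The increasing `(k + 1)`-tuples whose first entry is less than `M` and whose other entries
lie in `[M, Y)`. -/
def crossingTuples {n : ℕ} (k M Y : ℕ) : Finset (Fin (k + 1) → Fin n) :=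
  {w | StrictMono w ∧ (w 0 : ℕ) < M ∧ ∀ j : Fin k, M ≤ (w j.succ : ℕ) ∧ (w j.succ : ℕ) < Y}

theorem card_filter_val_lt {n M : ℕ} (h : M ≤ n) :
    Finset.card {v : Fin n | (v : ℕ) < M} = M := by
  rw [Fin.card_filter_val_lt, min_eq_right h]

theorem card_filter_val_mem_Ico {n M Y : ℕ} (h : Y ≤ n) :
    Finset.card {v : Fin n | M ≤ (v : ℕ) ∧ (v : ℕ) < Y} = Y - M := by
  rw [← Nat.card_Ico M Y, ← Finset.card_map Fin.valEmbedding]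
  congr 1
  ext x
  simp only [Finset.mem_map, Finset.mem_filter, Finset.mem_univ, true_and, Fin.valEmbedding_apply,
    Finset.mem_Ico]
  exact ⟨by rintro ⟨v, hv, rfl⟩; exact hv, fun hx => ⟨⟨x, by omega⟩, hx, rfl⟩⟩

/-- The first entry and the tail are chosen independently: the threshold `M` separates them, so the
junction is automatically increasing. -/
theorem card_crossingTuples {n k M Y : ℕ} (hMY : M ≤ Y) (hY : Y ≤ n) :
    (crossingTuples k M Y : Finset (Fin (k + 1) → Fin n)).card = M * (Y - M).choose k := by
  classical
  have h1 : (({v | (v : ℕ) < M} : Finset (Fin n)) ×ˢ increasingTuples k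
      ({v | M ≤ (v : ℕ) ∧ (v : ℕ) < Y} : Finset (Fin n))).card = M * (Y - M).choose k := by
    rw [Finset.card_product, card_increasingTuples, card_filter_val_mem_Ico hY,
      card_filter_val_lt (hMY.trans hY)]
  rw [← h1]
  refine Finset.card_bij' (fun w _ => (w 0, Fin.tail w))
    (fun p _ => Fin.cons p.1 p.2) ?_ ?_ ?_ ?_
  · intro w hw
    simp only [crossingTuples, Finset.mem_filter, Finset.mem_univ, true_and] at hw
    simp only [increasingTuples, Finset.mem_product, Finset.mem_filter, Finset.mem_univ, true_and]
    exact ⟨hw.2.1, fun a b hab => hw.1 (Fin.succ_lt_succ_iff.2 hab), hw.2.2⟩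
  · rintro ⟨a, v⟩ hp
    simp only [increasingTuples, Finset.mem_product, Finset.mem_filter, Finset.mem_univ,
      true_and] at hp
    simp only [crossingTuples, Finset.mem_filter, Finset.mem_univ, true_and, Fin.cons_zero,
      Fin.cons_succ]
    refine ⟨?_, hp.1, hp.2.2⟩
    intro x y
    refine Fin.cases ?_ (fun x => ?_) x <;> refine Fin.cases ?_ (fun y => ?_) y
    · simp
    · intro _
      simp only [Fin.cons_zero, Fin.cons_succ]
      exact Fin.lt_def.2 (hp.1.trans_le (hp.2.2 y).1)
    · intro h
      exact absurd h (by simp)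
    · intro h
      simpa using hp.2.1 (Fin.succ_lt_succ_iff.1 h)
  · intro w _
    simp
  · intro p _
    simp

/-- The number of entries of `π` smaller than `Y` in runs whose smallest entry is smaller
than `M`. -/
def lowRunCount {n : ℕ} (M Y : ℕ) (π : Equiv.Perm (Fin n)) : ℕ :=
  Finset.card {i : Fin n | (runMin π i : ℕ) < M ∧ (π i : ℕ) < Y}

theorem runMin_le {n : ℕ} {π : Equiv.Perm (Fin n)} {i j : Fin n} (h : j ∈ run π i) :
    runMin π i ≤ π j :=
  Finset.inf'_le _ h

theorem exists_mem_run_eq_runMin {n : ℕ} (π : Equiv.Perm (Fin n)) (i : Fin n) :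
    ∃ j ∈ run π i, runMin π i = π j :=
  Finset.exists_mem_eq_inf' _ _

theorem lowRunCount_of_le {n M Y : ℕ} (h : Y ≤ M) (hY : Y ≤ n) (π : Equiv.Perm (Fin n)) :
    lowRunCount M Y π = Y := by
  refine Eq.trans ?_ (card_filter_val_lt hY)
  refine Finset.card_bij (fun i _ => π i) ?_ (fun _ _ _ _ h => π.injective h) ?_
  · intro i hi
    simpa using (Finset.mem_filter.1 hi).2.2
  · intro v hv
    refine ⟨π.symm v, ?_, by simp⟩
    simp only [Finset.mem_filter, Finset.mem_univ, true_and, Equiv.apply_symm_apply] at hv ⊢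
    refine ⟨?_, hv⟩
    have := Fin.le_def.1 (runMin_le (mem_run_self π (π.symm v)))
    simp only [Equiv.apply_symm_apply] at this
    omega

theorem window_last {n k : ℕ} (i : Fin n) : window k i (Fin.last k) = i := by
  ext
  simp [window]

theorem strictMono_of_mem_crossingTuples {n k M Y : ℕ} {w : Fin (k + 1) → Fin n}
    (h : w ∈ crossingTuples k M Y) : StrictMono w :=
  (Finset.mem_filter.1 h).2.1

theorem start_mem_run {n k : ℕ} {π : Equiv.Perm (Fin n)} {i : Fin n}
    (h : StrictMono (π ∘ window k i)) : window k i 0 ∈ run π i := by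
  have hle : window k i 0 ≤ i := Fin.le_def.2 (by simp [window])
  simp only [run, Finset.mem_filter, Finset.mem_univ, true_and, min_eq_right hle, max_eq_left hle]
  intro a b ha hab hb
  simp only [Fin.le_def, Fin.lt_def, window, Fin.val_zero] at ha hab hb
  have hwa : window k i ⟨a + k - i, by omega⟩ = a := by
    ext
    simp only [window]
    omega
  have hwb : window k i ⟨b + k - i, by omega⟩ = b := by
    ext
    simp only [window]
    omega
  have := @h ⟨a + k - i, by omega⟩ ⟨b + k - i, by omega⟩ (Fin.lt_def.2 (by simp only; omega))
  rwa [Function.comp_apply, Function.comp_apply, hwa, hwb] at this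

/-- A position is counted for at most one `k`: with `k < l` both occurring, the entry `k` steps back
would be below `M` for the first window and at least `M` for the second. -/
theorem sum_windowCount_crossingTuples_le {n M Y : ℕ} (hMY : M ≤ Y) (K : ℕ)
    (π : Equiv.Perm (Fin n)) :
    ∑ k ∈ Finset.range K, windowCount (crossingTuples k M Y) π ≤ lowRunCount M Y π := by
  classical
  simp only [windowCount]
  rw [← Finset.card_biUnion]
  · refine Finset.card_le_card fun i hi => ?_
    simp only [Finset.mem_biUnion, Finset.mem_filter, Finset.mem_univ, true_and] at hi ⊢
    obtain ⟨k, -, hk⟩ := hi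
    have hk2 := hk
    simp only [crossingTuples, Finset.mem_filter, Finset.mem_univ, true_and] at hk2
    refine ⟨lt_of_le_of_lt (Fin.le_def.1 (runMin_le (start_mem_run hk2.1))) hk2.2.1, ?_⟩
    -- For `k = 0` the only entry is the one below `M`, and `M ≤ Y` is what bounds it by `Y`.
    rcases k with _ | k
    · have := hk2.2.1
      rw [show (0 : Fin (0 + 1)) = Fin.last 0 from rfl, Function.comp_apply, window_last] at this
      omega
    · have := (hk2.2.2 (Fin.last k)).2
      rwa [Fin.succ_last, Function.comp_apply, window_last] at this
  · have key : ∀ k l : ℕ, k < l → ∀ i : Fin n, (π ∘ window k i) ∈ crossingTuples k M Y →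
        (π ∘ window l i) ∈ crossingTuples l M Y → False := by
      intro k l hkl i h1 h2
      have hle := le_of_comp_window_mem
        (fun w hw => (strictMono_of_mem_crossingTuples hw).injective) h2
      simp only [crossingTuples, Finset.mem_filter, Finset.mem_univ, true_and] at h1 h2
      have h3 := (h2.2.2 ⟨l - k - 1, by omega⟩).1
      have hw : window l i (Fin.succ ⟨l - k - 1, by omega⟩) = window k i 0 := by
        ext
        simp only [window, Fin.val_succ, Fin.val_zero]
        omega
      rw [Function.comp_apply, hw] at h3
      exact absurd h1.2.1 (not_lt.2 h3)
    intro k _ l _ hkl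
    rw [Function.onFun, Finset.disjoint_left]
    intro i h1 h2
    simp only [Finset.mem_filter, Finset.mem_univ, true_and] at h1 h2
    rcases lt_or_gt_of_ne hkl with h | h
    · exact key k l h i h1 h2
    · exact key l k h i h2 h1

/-- Let `k` be the number of steps left to the nearest entry below `M`. Either `k ≤ K`, giving a
crossing tuple, or the last `K + 1` entries increase inside `[M, Y)`. The latter are rare for large
`K` and serve as the error term. -/
theorem lowRunCount_le {n M Y : ℕ} (K : ℕ) (π : Equiv.Perm (Fin n)) :
    lowRunCount M Y π ≤ ∑ k ∈ Finset.range (K + 1), windowCount (crossingTuples k M Y) π +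
      windowCount (increasingTuples (K + 1)
        ({v | M ≤ (v : ℕ) ∧ (v : ℕ) < Y} : Finset (Fin n))) π := by
  classical
  simp only [windowCount]
  refine le_trans ?_ (Nat.add_le_add_right Finset.card_biUnion_le _)
  refine le_trans (Finset.card_le_card ?_) (Finset.card_union_le _ _)
  intro i hi
  simp only [Finset.mem_filter, Finset.mem_univ, true_and] at hi
  obtain ⟨hiM, hiY⟩ := hi
  obtain ⟨j, hj, hjM⟩ : ∃ j, (j ≤ i ∧ ∀ a b : Fin n, j ≤ a → a < b → b ≤ i → π a < π b) ∧
      (π j : ℕ) < M := by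
    obtain ⟨j, hj, hjr⟩ := exists_mem_run_eq_runMin π i
    rw [hjr] at hiM
    simp only [run, Finset.mem_filter, Finset.mem_univ, true_and] at hj
    rcases le_or_gt j i with h | h
    · rw [min_eq_right h, max_eq_left h] at hj
      exact ⟨j, ⟨h, fun a b h1 h2 h3 => hj a b h1 h2 h3⟩, hiM⟩
    -- A minimum to the right would make the entry at `i` smaller still, so `i` itself serves as the
    -- witness.
    · rw [min_eq_left h.le, max_eq_right h.le] at hj
      refine ⟨i, ⟨le_rfl, fun a b h1 h2 h3 => absurd (h1.trans_lt h2) (not_lt.2 h3)⟩, ?_⟩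
      exact lt_trans (Fin.lt_def.1 (hj i j le_rfl h le_rfl)) hiM
  have hex : ∃ k, k ≤ (i : ℕ) ∧ (π ⟨i - k, by omega⟩ : ℕ) < M := by
    have := Fin.le_def.1 hj.1
    refine ⟨i - j, by omega, ?_⟩
    rwa [show (⟨i - (i - j), by omega⟩ : Fin n) = j from Fin.ext (by simp only; omega)]
  obtain ⟨hki, hkM⟩ := Nat.find_spec hex
  have hmin := fun m => Nat.find_min hex (m := m)
  have hkj : j ≤ (i : ℕ) - Nat.find hex := by
    have := Fin.le_def.1 hj.1
    have h := Nat.find_min' hex (m := i - j) ⟨by omega, by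
      rwa [show (⟨i - (i - j), by omega⟩ : Fin n) = j from Fin.ext (by simp only; omega)]⟩
    omega
  set k := Nat.find hex with hk
  have hmono : ∀ l, l ≤ k → StrictMono (π ∘ window l i) := by
    intro l hl a b hab
    have := Fin.lt_def.1 hab
    refine hj.2 _ _ ?_ ?_ ?_
    · simp only [Fin.le_def, window]
      omega
    · simp only [Fin.lt_def, window]
      omega
    · simp only [Fin.le_def, window]
      omega
  have hge : ∀ m, m < k → M ≤ (π ⟨i - m, by omega⟩ : ℕ) := by
    intro m hm
    by_contra h
    exact hmin m hm ⟨by omega, not_le.1 h⟩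
  have hlt : ∀ l, l ≤ k → ∀ a : Fin (l + 1), ((π ∘ window l i) a : ℕ) < Y := by
    intro l hl a
    have h := Fin.le_def.1 ((hmono l hl).monotone (Fin.le_last a))
    rw [Function.comp_apply (x := Fin.last l), window_last] at h
    omega
  simp only [Finset.mem_union, Finset.mem_biUnion, Finset.mem_range, Finset.mem_filter,
    Finset.mem_univ, true_and]
  rcases Nat.lt_or_ge k (K + 1) with hK | hK
  · refine Or.inl ⟨k, hK, ?_⟩
    simp only [crossingTuples, Finset.mem_filter, Finset.mem_univ, true_and]
    refine ⟨hmono k le_rfl, ?_, fun a => ⟨?_, hlt k le_rfl _⟩⟩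
    · simpa [window] using hkM
    · simpa [window] using hge (k - (a + 1)) (by omega)
  · refine Or.inr ?_
    simp only [increasingTuples, Finset.mem_filter, Finset.mem_univ, true_and]
    refine ⟨hmono K (by omega), fun a => ⟨?_, hlt K (by omega) a⟩⟩
    simpa [window] using hge (K - a) (by omega)

/-! ### The limiting proportion of entries in low runs. -/

theorem tendsto_choose_div_pow {L : ℕ → ℕ} {l : ℝ}
    (h : Tendsto (fun n => (L n : ℝ) / n) atTop (𝓝 l)) (k : ℕ) :
    Tendsto (fun n => ((L n).choose k : ℝ) / (n : ℝ) ^ k) atTop (𝓝 (l ^ k / k.factorial)) := by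
  refine ((tendsto_descFactorial_div_pow h k).div_const (k.factorial : ℝ)).congr fun n => ?_
  have : (k.factorial : ℝ) ≠ 0 := by positivity
  rw [Nat.descFactorial_eq_factorial_mul_choose, Nat.cast_mul]
  field_simp

theorem tendsto_natCeil_mul_div {a : ℝ} (ha : 0 ≤ a) :
    Tendsto (fun n : ℕ => (⌈a * n⌉₊ : ℝ) / n) atTop (𝓝 a) :=
  (tendsto_nat_ceil_mul_div_atTop ha).comp tendsto_natCast_atTop_atTop

theorem natCeil_mul_le {a : ℝ} (ha : a ≤ 1) (n : ℕ) : ⌈a * n⌉₊ ≤ n :=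
  Nat.ceil_le.2 (mul_le_of_le_one_left (Nat.cast_nonneg n) ha)

theorem natCeil_mul_mono {a b : ℝ} (h : a ≤ b) (n : ℕ) : ⌈a * n⌉₊ ≤ ⌈b * n⌉₊ :=
  Nat.ceil_mono (mul_le_mul_of_nonneg_right h (Nat.cast_nonneg n))

theorem tendsto_natCeil_sub_div {a b : ℝ} (ha : 0 ≤ a) (hab : a ≤ b) :
    Tendsto (fun n : ℕ => ((⌈b * n⌉₊ - ⌈a * n⌉₊ : ℕ) : ℝ) / n) atTop (𝓝 (b - a)) := by
  refine ((tendsto_natCeil_mul_div (ha.trans hab)).sub (tendsto_natCeil_mul_div ha)).congr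
    fun n => ?_
  rw [Nat.cast_sub (natCeil_mul_mono hab n)]
  ring

theorem tendstoInMean_windowCount_crossingTuples {s y : ℝ} (hs : 0 ≤ s) (hsy : s ≤ y) (hy : y ≤ 1)
    (k : ℕ) :
    TendstoInMean (fun n π => (windowCount (crossingTuples k ⌈s * n⌉₊ ⌈y * n⌉₊) π : ℝ) / n)
      (s * ((y - s) ^ k / k.factorial)) := by
  refine tendstoInMean_windowCount (fun n => crossingTuples k ⌈s * n⌉₊ ⌈y * n⌉₊)
    (fun n w hw => (strictMono_of_mem_crossingTuples hw).injective) ?_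
  refine ((tendsto_natCeil_mul_div hs).mul
    (tendsto_choose_div_pow (tendsto_natCeil_sub_div hs hsy) k)).congr fun n => ?_
  rw [card_crossingTuples (natCeil_mul_mono hsy n) (natCeil_mul_le hy n), Nat.cast_mul, pow_succ']
  ring

theorem tendstoInMean_windowCount_increasingTuples {s y : ℝ} (hs : 0 ≤ s) (hsy : s ≤ y)
    (hy : y ≤ 1) (k : ℕ) :
    TendstoInMean (fun n π => (windowCount (increasingTuples (k + 1)
      ({v | ⌈s * n⌉₊ ≤ (v : ℕ) ∧ (v : ℕ) < ⌈y * n⌉₊} : Finset (Fin n))) π : ℝ) / n)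
      ((y - s) ^ (k + 1) / (k + 1).factorial) := by
  refine tendstoInMean_windowCount (fun n => increasingTuples (k + 1)
      ({v | ⌈s * n⌉₊ ≤ (v : ℕ) ∧ (v : ℕ) < ⌈y * n⌉₊} : Finset (Fin n)))
    (fun n w hw => (Finset.mem_filter.1 hw).2.1.injective) ?_
  refine (tendsto_choose_div_pow (tendsto_natCeil_sub_div hs hsy) (k + 1)).congr fun n => ?_
  rw [card_increasingTuples, card_filter_val_mem_Ico (natCeil_mul_le hy n)]

theorem tendstoInMean_lowRunCount_of_le {s y : ℝ} (hs : 0 ≤ s) (hsy : s ≤ y) (hy : y ≤ 1) :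
    TendstoInMean (fun n π => (lowRunCount ⌈s * n⌉₊ ⌈y * n⌉₊ π : ℝ) / n)
      (s * Real.exp (y - s)) := by
  set c : ℕ → ℝ := fun k => s * ((y - s) ^ k / k.factorial) with hc
  set t : ℕ → ℝ := fun k => (y - s) ^ (k + 1) / (k + 1).factorial with ht
  have hsum : Tendsto (fun K => ∑ k ∈ Finset.range (K + 1), c k) atTop
      (𝓝 (s * Real.exp (y - s))) := by
    have h := (NormedSpace.expSeries_div_hasSum_exp (y - s)).mul_left s
    rw [← congrFun Real.exp_eq_exp_ℝ (y - s)] at h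
    exact h.tendsto_sum_nat.comp (tendsto_add_atTop_nat 1)
  have htail : Tendsto t atTop (𝓝 0) :=
    (FloorSemiring.tendsto_pow_div_factorial_atTop (y - s)).comp (tendsto_add_atTop_nat 1)
  have herr : Tendsto (fun K => t K + |∑ k ∈ Finset.range (K + 1), c k - s * Real.exp (y - s)|)
      atTop (𝓝 0) := by
    have := htail.add (hsum.sub_const (s * Real.exp (y - s))).abs
    simpa using this
  rw [TendstoInMean, tendsto_order]
  refine ⟨fun a ha => Eventually.of_forall fun n => ha.trans_le
    (Finset.expect_nonneg fun π _ => abs_nonneg _), fun ε hε => ?_⟩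
  -- The truncation level is fixed before `n`, so only finitely many window counts have to converge.
  obtain ⟨K, hK⟩ := (herr.eventually (gt_mem_nhds (half_pos hε))).exists
  have hmain : Tendsto (fun n : ℕ => ∑ k ∈ Finset.range (K + 1), (𝔼 π : Equiv.Perm (Fin n),
      |(windowCount (crossingTuples k ⌈s * n⌉₊ ⌈y * n⌉₊) π : ℝ) / n - c k|) +
      𝔼 π : Equiv.Perm (Fin n), |(windowCount (increasingTuples (K + 1)
        ({v | ⌈s * n⌉₊ ≤ (v : ℕ) ∧ (v : ℕ) < ⌈y * n⌉₊} : Finset (Fin n))) π : ℝ) / n - t K|)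
      atTop (𝓝 0) := by
    have := (tendsto_finsetSum (Finset.range (K + 1)) fun k _ =>
      tendstoInMean_windowCount_crossingTuples hs hsy hy k).add
      (tendstoInMean_windowCount_increasingTuples hs hsy hy K)
    simpa using this
  filter_upwards [hmain.eventually (gt_mem_nhds (half_pos hε))] with n hn
  rw [← Finset.expect_sum_comm, ← Finset.expect_add_distrib] at hn
  refine lt_of_le_of_lt ?_ (add_lt_add hn hK |>.trans_eq (add_halves ε))
  rw [← Fintype.expect_const (ι := Equiv.Perm (Fin n))
    (t K + |∑ k ∈ Finset.range (K + 1), c k - s * Real.exp (y - s)|), ← Finset.expect_add_distrib]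
  refine Finset.expect_le_expect fun π _ => ?_
  have hlo : ∑ k ∈ Finset.range (K + 1),
      (windowCount (crossingTuples k ⌈s * n⌉₊ ⌈y * n⌉₊) π : ℝ) / n ≤
      (lowRunCount ⌈s * n⌉₊ ⌈y * n⌉₊ π : ℝ) / n := by
    rw [← Finset.sum_div]
    gcongr
    exact_mod_cast sum_windowCount_crossingTuples_le (natCeil_mul_mono hsy n) (K + 1) π
  have hup : (lowRunCount ⌈s * n⌉₊ ⌈y * n⌉₊ π : ℝ) / n ≤ ∑ k ∈ Finset.range (K + 1),
      (windowCount (crossingTuples k ⌈s * n⌉₊ ⌈y * n⌉₊) π : ℝ) / n +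
      (windowCount (increasingTuples (K + 1)
        ({v | ⌈s * n⌉₊ ≤ (v : ℕ) ∧ (v : ℕ) < ⌈y * n⌉₊} : Finset (Fin n))) π : ℝ) / n := by
    rw [← Finset.sum_div, ← add_div]
    gcongr
    exact_mod_cast lowRunCount_le K π
  have habs := Finset.abs_sum_le_sum_abs (fun k =>
    (windowCount (crossingTuples k ⌈s * n⌉₊ ⌈y * n⌉₊) π : ℝ) / n - c k) (Finset.range (K + 1))
  rw [Finset.sum_sub_distrib] at habs
  have ht0 : 0 ≤ t K := by
    have : 0 ≤ y - s := by linarith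
    positivity
  have h1 := abs_le.1 habs
  have h2 := neg_abs_le (∑ k ∈ Finset.range (K + 1), c k - s * Real.exp (y - s))
  have h3 := le_abs_self (∑ k ∈ Finset.range (K + 1), c k - s * Real.exp (y - s))
  have h4 := le_abs_self ((windowCount (increasingTuples (K + 1)
        ({v | ⌈s * n⌉₊ ≤ (v : ℕ) ∧ (v : ℕ) < ⌈y * n⌉₊} : Finset (Fin n))) π : ℝ) / n - t K)
  have h5 := abs_nonneg ((windowCount (increasingTuples (K + 1)
        ({v | ⌈s * n⌉₊ ≤ (v : ℕ) ∧ (v : ℕ) < ⌈y * n⌉₊} : Finset (Fin n))) π : ℝ) / n - t K)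
  rw [abs_le]
  constructor <;> linarith [h1.1, h1.2]

/-- The asymptotic proportion of the entries less than `y` that lie in runs with smallest entry
less than `s`, where entries are scaled to the unit interval. -/
noncomputable def lowRunDensity (s y : ℝ) : ℝ := if y ≤ s then y else s * Real.exp (y - s)

theorem tendstoInMean_lowRunCount {s y : ℝ} (hs : 0 ≤ s) (hy0 : 0 ≤ y) (hy : y ≤ 1) :
    TendstoInMean (fun n π => (lowRunCount ⌈s * n⌉₊ ⌈y * n⌉₊ π : ℝ) / n) (lowRunDensity s y) := by
  rcases le_or_gt y s with h | h
  · rw [lowRunDensity, if_pos h, TendstoInMean]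
    have : ∀ (n : ℕ) (π : Equiv.Perm (Fin n)), lowRunCount ⌈s * n⌉₊ ⌈y * n⌉₊ π = ⌈y * n⌉₊ :=
      fun n π => lowRunCount_of_le (natCeil_mul_mono h n) (natCeil_mul_le hy n) π
    simp only [this, Fintype.expect_const]
    simpa using ((tendsto_natCeil_mul_div hy0).sub_const y).abs
  · rw [lowRunDensity, if_neg (not_le.2 h)]
    exact tendstoInMean_lowRunCount_of_le hs h.le hy

/-! ### The curve as a change of variable on the unit interval. -/

/-- The map `y ↦ y e ^ (1 - y)` parametrizing the curve that carries the singular part of the runsort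
permuton. -/
noncomputable def curve (s : ℝ) : ℝ := s * Real.exp (1 - s)

theorem curve_zero : curve 0 = 0 := by simp [curve]

theorem curve_one : curve 1 = 1 := by simp [curve]

theorem continuous_curve : Continuous curve := by
  unfold curve
  fun_prop

theorem hasDerivAt_curve (s : ℝ) : HasDerivAt curve ((1 - s) * Real.exp (1 - s)) s := by
  have h : HasDerivAt (fun s : ℝ => s * Real.exp (1 - s))
      (1 * Real.exp (1 - s) + s * (Real.exp (1 - s) * -1)) s :=
    (hasDerivAt_id' s).mul ((hasDerivAt_id' s).const_sub 1).exp
  exact h.congr_deriv (by ring)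

theorem curve_strictMonoOn : StrictMonoOn curve (Icc 0 1) := by
  refine strictMonoOn_of_deriv_pos (convex_Icc 0 1) continuous_curve.continuousOn fun s hs => ?_
  rw [interior_Icc] at hs
  rw [(hasDerivAt_curve s).deriv]
  have : 0 < 1 - s := by linarith [hs.2]
  positivity

theorem curve_mem_Icc {s : ℝ} (hs : s ∈ Icc (0 : ℝ) 1) : curve s ∈ Icc (0 : ℝ) 1 := by
  have h0 := curve_strictMonoOn.monotoneOn (left_mem_Icc.2 zero_le_one) hs hs.1
  have h1 := curve_strictMonoOn.monotoneOn hs (right_mem_Icc.2 zero_le_one) hs.2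
  rw [curve_zero] at h0
  rw [curve_one] at h1
  exact ⟨h0, h1⟩

theorem exists_curve_eq {x : ℝ} (hx : x ∈ Icc (0 : ℝ) 1) : ∃ s ∈ Icc (0 : ℝ) 1, curve s = x := by
  have h := intermediate_value_Icc zero_le_one (continuous_curve.continuousOn (s := Icc 0 1))
  rw [curve_zero, curve_one] at h
  exact h hx

theorem abs_curve_sub_le {s t : ℝ} (hs : s ∈ Icc (0 : ℝ) 1) (ht : t ∈ Icc (0 : ℝ) 1) :
    |curve s - curve t| ≤ Real.exp 1 * |s - t| := by
  refine (convex_Icc (0 : ℝ) 1).norm_image_sub_le_of_norm_hasDerivWithin_le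
    (fun x _ => (hasDerivAt_curve x).hasDerivWithinAt) (fun x hx => ?_) ht hs
  have h0 : 0 ≤ 1 - x := by linarith [hx.2]
  rw [Real.norm_of_nonneg (by positivity)]
  have h1 : Real.exp (1 - x) ≤ Real.exp 1 := Real.exp_le_exp.2 (by linarith [hx.1])
  calc (1 - x) * Real.exp (1 - x) ≤ 1 * Real.exp 1 := by
        gcongr
        linarith [hx.1]
    _ = _ := one_mul _

/-! ### Distribution functions of permutons and the rectangle distance. -/

/-- The distribution function of a measure on the unit square. -/
noncomputable def boxMass (γ : Measure (ℝ × ℝ)) (x y : ℝ) : ℝ := γ.real (Icc 0 x ×ˢ Icc 0 y)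

namespace IsPermuton

variable {γ : Measure (ℝ × ℝ)}

theorem of_marginals (h0 : IsProbabilityMeasure γ)
    (h1 : ∀ a b : ℝ, 0 ≤ a → a ≤ b → b ≤ 1 →
      γ (Icc a b ×ˢ Icc (0 : ℝ) 1) = ENNReal.ofReal (b - a))
    (h2 : ∀ a b : ℝ, 0 ≤ a → a ≤ b → b ≤ 1 →
      γ (Icc (0 : ℝ) 1 ×ˢ Icc a b) = ENNReal.ofReal (b - a)) : IsPermuton γ where
  isProbabilityMeasure := h0
  outside := by
    rw [prob_compl_eq_zero_iff (measurableSet_Icc.prod measurableSet_Icc),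
      h1 0 1 le_rfl zero_le_one le_rfl]
    simp
  marginal_fst := h1
  marginal_snd := h2

/-- The two closed pieces overlap in a vertical segment, which is null by the uniform marginal. -/
theorem real_Icc_prod_add (h : IsPermuton γ) {a b c : ℝ} (ha : 0 ≤ a) (hab : a ≤ b) (hbc : b ≤ c)
    (hc : c ≤ 1) {T : Set ℝ} (hT : T ⊆ Icc 0 1) (hTm : MeasurableSet T) :
    γ.real (Icc a c ×ˢ T) = γ.real (Icc a b ×ˢ T) + γ.real (Icc b c ×ˢ T) := by
  have := h.isProbabilityMeasure
  rw [← measureReal_union_add_inter (measurableSet_Icc.prod hTm), ← union_prod,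
    Icc_union_Icc_eq_Icc hab hbc, left_eq_add, measureReal_eq_zero_iff]
  refine measure_mono_null ?_ ((h.marginal_fst b b (ha.trans hab) le_rfl (hbc.trans hc)).trans
    (by simp))
  rintro ⟨x, y⟩ ⟨⟨h1, h2⟩, h3, _⟩
  exact ⟨⟨h3.1, h1.2⟩, hT h2⟩

theorem real_prod_Icc_add (h : IsPermuton γ) {a b c : ℝ} (ha : 0 ≤ a) (hab : a ≤ b) (hbc : b ≤ c)
    (hc : c ≤ 1) {T : Set ℝ} (hT : T ⊆ Icc 0 1) (hTm : MeasurableSet T) :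
    γ.real (T ×ˢ Icc a c) = γ.real (T ×ˢ Icc a b) + γ.real (T ×ˢ Icc b c) := by
  have := h.isProbabilityMeasure
  rw [← measureReal_union_add_inter (hTm.prod measurableSet_Icc), ← prod_union,
    Icc_union_Icc_eq_Icc hab hbc, left_eq_add, measureReal_eq_zero_iff]
  refine measure_mono_null ?_ ((h.marginal_snd b b (ha.trans hab) le_rfl (hbc.trans hc)).trans
    (by simp))
  rintro ⟨x, y⟩ ⟨⟨h1, h2⟩, _, h3⟩
  exact ⟨hT h1, ⟨h3.1, h2.2⟩⟩

theorem real_rectangle (h : IsPermuton γ) {x₁ x₂ y₁ y₂ : ℝ} (hx₁ : 0 ≤ x₁) (hx : x₁ ≤ x₂)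
    (hx₂ : x₂ ≤ 1) (hy₁ : 0 ≤ y₁) (hy : y₁ ≤ y₂) (hy₂ : y₂ ≤ 1) :
    γ.real (Icc x₁ x₂ ×ˢ Icc y₁ y₂) =
      boxMass γ x₂ y₂ - boxMass γ x₁ y₂ - boxMass γ x₂ y₁ + boxMass γ x₁ y₁ := by
  have h1 := h.real_Icc_prod_add le_rfl hx₁ hx hx₂ (Icc_subset_Icc_right hy₂ : Icc 0 y₂ ⊆ Icc 0 1)
    measurableSet_Icc
  have h2 := h.real_Icc_prod_add le_rfl hx₁ hx hx₂
    (Icc_subset_Icc_right (hy.trans hy₂) : Icc 0 y₁ ⊆ Icc 0 1) measurableSet_Icc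
  have h3 := h.real_prod_Icc_add le_rfl hy₁ hy hy₂ (Icc_subset_Icc hx₁ hx₂) measurableSet_Icc
  simp only [boxMass]
  linarith

theorem abs_boxMass_sub_fst_le (h : IsPermuton γ) {x x' y : ℝ} (hx : x ∈ Icc (0 : ℝ) 1)
    (hx' : x' ∈ Icc (0 : ℝ) 1) (hy : y ≤ 1) : |boxMass γ x y - boxMass γ x' y| ≤ |x - x'| := by
  have := h.isProbabilityMeasure
  wlog hle : x ≤ x' generalizing x x'
  · rw [abs_sub_comm, abs_sub_comm x]
    exact this hx' hx (le_of_not_ge hle)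
  have h1 := h.real_Icc_prod_add le_rfl hx.1 hle hx'.2 (Icc_subset_Icc_right hy : Icc 0 y ⊆ Icc 0 1)
    measurableSet_Icc
  have h2 : γ.real (Icc x x' ×ˢ Icc 0 y) ≤ x' - x := by
    refine ENNReal.toReal_le_of_le_ofReal (by linarith) ?_
    rw [← h.marginal_fst x x' hx.1 hle hx'.2]
    exact measure_mono (prod_mono le_rfl (Icc_subset_Icc_right hy))
  have h3 : 0 ≤ γ.real (Icc x x' ×ˢ Icc 0 y) := measureReal_nonneg
  rw [abs_sub_comm, abs_sub_comm x, abs_of_nonneg (by linarith : 0 ≤ x' - x)]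
  simp only [boxMass]
  rw [abs_le]
  constructor <;> linarith

theorem abs_boxMass_sub_snd_le (h : IsPermuton γ) {x y y' : ℝ} (hx : x ≤ 1)
    (hy : y ∈ Icc (0 : ℝ) 1) (hy' : y' ∈ Icc (0 : ℝ) 1) :
    |boxMass γ x y - boxMass γ x y'| ≤ |y - y'| := by
  have := h.isProbabilityMeasure
  wlog hle : y ≤ y' generalizing y y'
  · rw [abs_sub_comm, abs_sub_comm y]
    exact this hy' hy (le_of_not_ge hle)
  have h1 := h.real_prod_Icc_add le_rfl hy.1 hle hy'.2 (Icc_subset_Icc_right hx : Icc 0 x ⊆ Icc 0 1)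
    measurableSet_Icc
  have h2 : γ.real (Icc 0 x ×ˢ Icc y y') ≤ y' - y := by
    refine ENNReal.toReal_le_of_le_ofReal (by linarith) ?_
    rw [← h.marginal_snd y y' hy.1 hle hy'.2]
    exact measure_mono (prod_mono (Icc_subset_Icc_right hx) le_rfl)
  have h3 : 0 ≤ γ.real (Icc 0 x ×ˢ Icc y y') := measureReal_nonneg
  rw [abs_sub_comm, abs_sub_comm y, abs_of_nonneg (by linarith : 0 ≤ y' - y)]
  simp only [boxMass]
  rw [abs_le]
  constructor <;> linarith

theorem abs_boxMass_sub_le (h : IsPermuton γ) {x x' y y' : ℝ} (hx : x ∈ Icc (0 : ℝ) 1)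
    (hx' : x' ∈ Icc (0 : ℝ) 1) (hy : y ∈ Icc (0 : ℝ) 1) (hy' : y' ∈ Icc (0 : ℝ) 1) :
    |boxMass γ x y - boxMass γ x' y'| ≤ |x - x'| + |y - y'| :=
  (abs_sub_le _ (boxMass γ x' y) _).trans
    (add_le_add (h.abs_boxMass_sub_fst_le hx hx' hy.2) (h.abs_boxMass_sub_snd_le hx'.2 hy hy'))

end IsPermuton

theorem exists_nat_div_near {s : ℝ} (hs : s ∈ Icc (0 : ℝ) 1) {N : ℕ} (hN : 0 < N) :
    ∃ j ∈ Finset.range (N + 1), |s - j / N| ≤ 1 / N ∧ (j / N : ℝ) ∈ Icc (0 : ℝ) 1 := by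
  have hN' : (0 : ℝ) < N := by exact_mod_cast hN
  have h0 : 0 ≤ s * N := mul_nonneg hs.1 hN'.le
  have h1 := Nat.floor_le h0
  have h2 := Nat.lt_floor_add_one (s * N)
  have h3 : s * N ≤ N := mul_le_of_le_one_left hN'.le hs.2
  refine ⟨⌊s * N⌋₊, ?_, ?_, by positivity, ?_⟩
  · rw [Finset.mem_range, Nat.lt_succ_iff]
    exact_mod_cast h1.trans h3
  · rw [abs_of_nonneg, sub_le_iff_le_add, ← add_div, le_div_iff₀ hN']
    · linarith
    · rw [sub_nonneg, div_le_iff₀ hN']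
      exact h1
  · rw [div_le_one hN']
    exact h1.trans h3

/-- Moving a corner to the grid costs at most `(e + 1) / N` for each measure, and a rectangle has
four corners. The grid is uniform in the parameter of `curve`, not in `x`, because the limits are
computed at abscissae `curve s`; the factor `e` is the Lipschitz constant of `curve`. -/
theorem rectDist_le {γ₁ γ₂ : Measure (ℝ × ℝ)} (h₁ : IsPermuton γ₁) (h₂ : IsPermuton γ₂) {N : ℕ}
    (hN : 0 < N) :
    rectDist γ₁ γ₂ ≤ 4 * (2 * ((Real.exp 1 + 1) / N) +
      ∑ j ∈ Finset.range (N + 1), ∑ l ∈ Finset.range (N + 1),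
        |boxMass γ₁ (curve (j / N)) (l / N) - boxMass γ₂ (curve (j / N)) (l / N)|) := by
  set S : ℝ := ∑ j ∈ Finset.range (N + 1), ∑ l ∈ Finset.range (N + 1),
    |boxMass γ₁ (curve (j / N)) (l / N) - boxMass γ₂ (curve (j / N)) (l / N)| with hS
  have hS0 : 0 ≤ S := Finset.sum_nonneg fun j _ => Finset.sum_nonneg fun l _ => abs_nonneg _
  have key : ∀ x ∈ Icc (0 : ℝ) 1, ∀ y ∈ Icc (0 : ℝ) 1,
      |boxMass γ₁ x y - boxMass γ₂ x y| ≤ 2 * ((Real.exp 1 + 1) / N) + S := by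
    intro x hx y hy
    obtain ⟨s, hs, rfl⟩ := exists_curve_eq hx
    obtain ⟨j, hj, hsj, hj1⟩ := exists_nat_div_near hs hN
    obtain ⟨l, hl, hyl, hl1⟩ := exists_nat_div_near hy hN
    have hcurve : |curve s - curve (j / N)| ≤ Real.exp 1 * (1 / N) :=
      (abs_curve_sub_le hs hj1).trans (by gcongr)
    have e1 := (h₁.abs_boxMass_sub_le hx (curve_mem_Icc hj1) hy hl1).trans
      (add_le_add hcurve hyl)
    have e2 := (h₂.abs_boxMass_sub_le hx (curve_mem_Icc hj1) hy hl1).trans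
      (add_le_add hcurve hyl)
    have e3 : |boxMass γ₁ (curve (j / N)) (l / N) - boxMass γ₂ (curve (j / N)) (l / N)| ≤ S :=
      (Finset.single_le_sum (f := fun l : ℕ => |boxMass γ₁ (curve (j / N)) (l / N) -
        boxMass γ₂ (curve (j / N)) (l / N)|) (fun l _ => abs_nonneg _) hl).trans
      (Finset.single_le_sum (f := fun j : ℕ => ∑ l ∈ Finset.range (N + 1),
        |boxMass γ₁ (curve (j / N)) (l / N) - boxMass γ₂ (curve (j / N)) (l / N)|)
        (fun j _ => Finset.sum_nonneg fun l _ => abs_nonneg _) hj)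
    have e4 : (Real.exp 1 + 1) / N = Real.exp 1 * (1 / N) + 1 / N := by ring
    rw [abs_le] at *
    constructor <;> linarith [e1.1, e1.2, e2.1, e2.2, e3.1, e3.2]
  refine Real.sSup_le ?_ (by positivity)
  rintro r ⟨x₁, x₂, y₁, y₂, hx₁, hx, hx₂, hy₁, hy, hy₂, rfl⟩
  rw [h₁.real_rectangle hx₁ hx hx₂ hy₁ hy hy₂, h₂.real_rectangle hx₁ hx hx₂ hy₁ hy hy₂]
  have m1 : x₁ ∈ Icc (0 : ℝ) 1 := ⟨hx₁, hx.trans hx₂⟩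
  have m2 : x₂ ∈ Icc (0 : ℝ) 1 := ⟨hx₁.trans hx, hx₂⟩
  have m3 : y₁ ∈ Icc (0 : ℝ) 1 := ⟨hy₁, hy.trans hy₂⟩
  have m4 : y₂ ∈ Icc (0 : ℝ) 1 := ⟨hy₁.trans hy, hy₂⟩
  have k1 := abs_le.1 (key x₂ m2 y₂ m4)
  have k2 := abs_le.1 (key x₁ m1 y₂ m4)
  have k3 := abs_le.1 (key x₂ m2 y₁ m3)
  have k4 := abs_le.1 (key x₁ m1 y₁ m3)
  rw [abs_le]
  constructor <;> linarith [k1.1, k1.2, k2.1, k2.2, k3.1, k3.2, k4.1, k4.2]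

/-! ### Permutation measures. -/

/-- The `j`-th of the `n` intervals of equal length into which the unit interval is divided. -/
def gridInterval (n j : ℕ) : Set ℝ := Ico ((j : ℝ) / n) (((j : ℝ) + 1) / n)

theorem plotCell_eq {n : ℕ} (σ : Equiv.Perm (Fin n)) (i : Fin n) :
    plotCell σ i = gridInterval n i ×ˢ gridInterval n (σ i) := rfl

theorem volume_gridInterval {n : ℕ} (hn : 0 < n) (j : ℕ) :
    volume (gridInterval n j) = (n : ENNReal)⁻¹ := by
  have : (0 : ℝ) < n := by exact_mod_cast hn
  rw [gridInterval, Real.volume_Ico, ← sub_div, add_sub_cancel_left, one_div,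
    ENNReal.ofReal_inv_of_pos this, ENNReal.ofReal_natCast]

theorem disjoint_gridInterval {n i j : ℕ} (hij : i ≠ j) :
    Disjoint (gridInterval n i) (gridInterval n j) := by
  wlog h : i < j generalizing i j
  · exact (this hij.symm (by omega)).symm
  rw [Set.disjoint_left]
  intro x hx hx'
  have h1 : (i : ℝ) + 1 ≤ j := by exact_mod_cast h
  have h2 : ((i : ℝ) + 1) / n ≤ j / n := by gcongr
  linarith [hx.2, hx'.1]

theorem iUnion_gridInterval {n : ℕ} (hn : 0 < n) :
    ⋃ i : Fin n, gridInterval n i = Ico (0 : ℝ) 1 := by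
  have hn' : (0 : ℝ) < n := by exact_mod_cast hn
  ext x
  simp only [mem_iUnion, gridInterval, mem_Ico, div_le_iff₀ hn', lt_div_iff₀ hn']
  constructor
  · rintro ⟨i, h1, h2⟩
    have h3 : (i : ℝ) + 1 ≤ n := by exact_mod_cast i.2
    have h4 : (0 : ℝ) ≤ (i : ℕ) := Nat.cast_nonneg _
    constructor <;> nlinarith
  · rintro ⟨h1, h2⟩
    have h0 : 0 ≤ x * n := by positivity
    refine ⟨⟨⌊x * n⌋₊, (Nat.floor_lt h0).2 (by nlinarith)⟩, Nat.floor_le h0,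
      Nat.lt_floor_add_one _⟩

theorem permMeasure_prod {n : ℕ} (σ : Equiv.Perm (Fin n)) {A B : Set ℝ} (hA : MeasurableSet A)
    (hB : MeasurableSet B) :
    permMeasure σ (A ×ˢ B) = n * ∑ i : Fin n, volume (A ∩ gridInterval n i) *
      volume (B ∩ gridInterval n (σ i)) := by
  rw [permMeasure, withDensity_const, Measure.smul_apply, smul_eq_mul,
    Measure.restrict_apply (hA.prod hB), inter_iUnion, measure_iUnion, tsum_fintype]
  · simp only [plotCell_eq, prod_inter_prod]
    congr 1
    refine Finset.sum_congr rfl fun i _ => ?_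
    rw [Measure.volume_eq_prod, Measure.prod_prod]
  · intro i j hij
    refine Disjoint.mono inter_subset_right inter_subset_right ?_
    rw [plotCell_eq, plotCell_eq, Set.disjoint_prod]
    exact Or.inl (disjoint_gridInterval fun h => hij (Fin.ext h))
  · intro i
    exact (hA.prod hB).inter (measurableSet_Ico.prod measurableSet_Ico)

theorem gridInterval_subset {n : ℕ} (hn : 0 < n) (i : Fin n) : gridInterval n i ⊆ Ico 0 1 := by
  rw [← iUnion_gridInterval hn]
  exact subset_iUnion (fun i : Fin n => gridInterval n i) i

theorem sum_volume_inter_gridInterval {n : ℕ} (hn : 0 < n) {A : Set ℝ} (hA : MeasurableSet A) :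
    ∑ i : Fin n, volume (A ∩ gridInterval n i) = volume (A ∩ Ico 0 1) := by
  rw [← iUnion_gridInterval hn, inter_iUnion, measure_iUnion, tsum_fintype]
  · intro i j hij
    exact Disjoint.mono inter_subset_right inter_subset_right
      (disjoint_gridInterval fun h => hij (Fin.ext h))
  · exact fun i => hA.inter measurableSet_Ico

theorem permMeasure_prod_of_Ico_subset {n : ℕ} (hn : 0 < n) (σ : Equiv.Perm (Fin n)) {A B : Set ℝ}
    (hA : MeasurableSet A) (hB : MeasurableSet B) (hIB : Ico 0 1 ⊆ B) :
    permMeasure σ (A ×ˢ B) = volume (A ∩ Ico 0 1) := by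
  have hne : (n : ENNReal) ≠ 0 := by
    rw [Nat.cast_ne_zero]
    omega
  rw [permMeasure_prod σ hA hB, ← sum_volume_inter_gridInterval hn hA, Finset.mul_sum]
  refine Finset.sum_congr rfl fun i _ => ?_
  rw [inter_eq_self_of_subset_right ((gridInterval_subset hn (σ i)).trans hIB),
    volume_gridInterval hn, mul_comm, mul_assoc, ENNReal.inv_mul_cancel hne (by simp), mul_one]

theorem permMeasure_prod_of_Ico_subset' {n : ℕ} (hn : 0 < n) (σ : Equiv.Perm (Fin n))
    {A B : Set ℝ} (hA : MeasurableSet A) (hB : MeasurableSet B) (hIA : Ico 0 1 ⊆ A) :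
    permMeasure σ (A ×ˢ B) = volume (B ∩ Ico 0 1) := by
  have hne : (n : ENNReal) ≠ 0 := by
    rw [Nat.cast_ne_zero]
    omega
  rw [permMeasure_prod σ hA hB, ← sum_volume_inter_gridInterval hn hB, Finset.mul_sum,
    ← Equiv.sum_comp σ fun i : Fin n => volume (B ∩ gridInterval n i)]
  refine Finset.sum_congr rfl fun i _ => ?_
  rw [inter_eq_self_of_subset_right ((gridInterval_subset hn i).trans hIA),
    volume_gridInterval hn, ← mul_assoc, ENNReal.mul_inv_cancel hne (by simp), one_mul]

theorem volume_Icc_inter_Ico_zero_one {a b : ℝ} (ha : 0 ≤ a) (hb : b ≤ 1) :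
    volume (Icc a b ∩ Ico 0 1) = ENNReal.ofReal (b - a) := by
  apply le_antisymm
  · rw [← Real.volume_Icc]
    exact measure_mono inter_subset_left
  · rw [← Real.volume_Ico]
    exact measure_mono fun x hx => ⟨Ico_subset_Icc_self hx, ha.trans hx.1, hx.2.trans_le hb⟩

theorem isPermuton_permMeasure {n : ℕ} (hn : 0 < n) (σ : Equiv.Perm (Fin n)) :
    IsPermuton (permMeasure σ) := by
  refine IsPermuton.of_marginals ⟨?_⟩ ?_ ?_
  · rw [← univ_prod_univ, permMeasure_prod_of_Ico_subset hn σ .univ .univ (subset_univ _)]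
    simp
  · intro a b ha _ hb
    rw [permMeasure_prod_of_Ico_subset hn σ measurableSet_Icc measurableSet_Icc
      Ico_subset_Icc_self, volume_Icc_inter_Ico_zero_one ha hb]
  · intro a b ha _ hb
    rw [permMeasure_prod_of_Ico_subset' hn σ measurableSet_Icc measurableSet_Icc
      Ico_subset_Icc_self, volume_Icc_inter_Ico_zero_one ha hb]

theorem volume_Icc_inter_gridInterval {n : ℕ} (hn : 0 < n) (a j : ℕ) :
    volume (Icc 0 ((a : ℝ) / n) ∩ gridInterval n j) = if j < a then (n : ENNReal)⁻¹ else 0 := by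
  split_ifs with h
  · rw [inter_eq_self_of_subset_right, volume_gridInterval hn]
    intro x hx
    have h1 : (j : ℝ) + 1 ≤ a := by exact_mod_cast h
    have h2 : ((j : ℝ) + 1) / n ≤ a / n := by gcongr
    exact ⟨le_trans (by positivity) hx.1, hx.2.le.trans h2⟩
  -- The box is closed, so it may still touch the next interval at its left endpoint.
  · refine measure_mono_null (t := {(a : ℝ) / n}) ?_ Real.volume_singleton
    intro x hx
    have h1 : (a : ℝ) ≤ j := by exact_mod_cast not_lt.1 h
    have h2 : (a : ℝ) / n ≤ j / n := by gcongr
    exact le_antisymm hx.1.2 (h2.trans hx.2.1)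

theorem boxMass_permMeasure_div {n : ℕ} (hn : 0 < n) (σ : Equiv.Perm (Fin n)) (a b : ℕ) :
    boxMass (permMeasure σ) (a / n) (b / n) =
      (Finset.card {i : Fin n | (i : ℕ) < a ∧ (σ i : ℕ) < b} : ℝ) / n := by
  have hne : (n : ENNReal) ≠ 0 := by
    rw [Nat.cast_ne_zero]
    omega
  have : permMeasure σ (Icc 0 ((a : ℝ) / n) ×ˢ Icc 0 ((b : ℝ) / n)) =
      (Finset.card {i : Fin n | (i : ℕ) < a ∧ (σ i : ℕ) < b} : ENNReal) * (n : ENNReal)⁻¹ := by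
    rw [permMeasure_prod σ measurableSet_Icc measurableSet_Icc, ← Finset.sum_boole, Finset.mul_sum,
      Finset.sum_mul]
    refine Finset.sum_congr rfl fun i _ => ?_
    rw [volume_Icc_inter_gridInterval hn, volume_Icc_inter_gridInterval hn, ← mul_assoc]
    by_cases h1 : (i : ℕ) < a <;> by_cases h2 : (σ i : ℕ) < b <;>
      simp [h1, h2, ENNReal.mul_inv_cancel hne]
  rw [boxMass, measureReal_def, this, ENNReal.toReal_mul, ENNReal.toReal_inv, div_eq_mul_inv]
  simp

/-! ### From sorted positions to run minima. -/

theorem mem_iff_lt_card_of_isLowerSet {n : ℕ} {S : Finset (Fin n)}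
    (hS : IsLowerSet (S : Set (Fin n))) (p : Fin n) : p ∈ S ↔ (p : ℕ) < S.card := by
  constructor
  · intro hp
    have : Finset.Iic p ⊆ S := fun q hq => hS (Finset.mem_Iic.1 hq) hp
    have := Finset.card_le_card this
    rw [Fin.card_Iic] at this
    omega
  · intro hp
    by_contra hpS
    have : S ⊆ Finset.Iio p := fun q hq =>
      Finset.mem_Iio.2 (not_le.1 fun h => hpS (hS h hq))
    have := Finset.card_le_card this
    rw [Fin.card_Iio] at this
    omega

/-- After sorting, the positions with run minimum below `M` form an initial segment, and
`lowRunCount M n π` is its length. The sorting permutation then matches the two counts. -/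
theorem card_lt_lowRunCount_and_runsort_lt {n : ℕ} (M Y : ℕ) (π : Equiv.Perm (Fin n)) :
    Finset.card {p : Fin n | (p : ℕ) < lowRunCount M n π ∧ (runsort π p : ℕ) < Y} =
      lowRunCount M Y π := by
  set τ := Tuple.sort (runMin π) with hτ
  have hmono : Monotone (runMin π ∘ τ) := Tuple.monotone_sort _
  set S : Finset (Fin n) := {p | (runMin π (τ p) : ℕ) < M} with hS
  have hlow : IsLowerSet (S : Set (Fin n)) := by
    intro p q hqp hp
    simp only [hS, Finset.coe_filter, Finset.mem_univ, true_and, mem_ofPred_eq] at hp ⊢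
    exact lt_of_le_of_lt (Fin.le_def.1 (hmono hqp)) hp
  have hcard : S.card = lowRunCount M n π :=
    Finset.card_equiv τ fun p => by simp [hS]
  rw [← hcard, lowRunCount]
  refine Finset.card_equiv τ fun p => ?_
  have hmem : p ∈ S ↔ (runMin π (τ p) : ℕ) < M := by simp [hS]
  rw [Finset.mem_filter, Finset.mem_filter, ← mem_iff_lt_card_of_isLowerSet hlow, hmem]
  simp only [Finset.mem_univ, true_and]
  rfl

/-! ### Masses, marginals and support of the runsort permuton. -/

theorem measurableSet_aboveCurve : MeasurableSet aboveCurve :=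
  (measurableSet_Icc.prod measurableSet_Icc).inter
    (measurableSet_lt measurable_fst (by fun_prop))

theorem mem_aboveCurve {p : ℝ × ℝ} :
    p ∈ aboveCurve ↔ p.1 ∈ Ico 0 (curve p.2) ∧ p.2 ∈ Icc (0 : ℝ) 1 := by
  change (p.1 ∈ Icc (0 : ℝ) 1 ∧ p.2 ∈ Icc (0 : ℝ) 1) ∧ p.1 < curve p.2 ↔ _
  constructor
  · rintro ⟨⟨h1, h2⟩, h3⟩
    exact ⟨⟨h1.1, h3⟩, h2⟩
  · rintro ⟨h1, h2⟩
    exact ⟨⟨⟨h1.1, h1.2.le.trans (curve_mem_Icc h2).2⟩, h2⟩, h1.2⟩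

theorem runsortPermuton_prod {A B : Set ℝ} (hA : MeasurableSet A) (hB : MeasurableSet B) :
    runsortPermuton (A ×ˢ B) = ∫⁻ y in B ∩ Icc 0 1,
      (ENNReal.ofReal (Real.exp (y - 1)) * volume (A ∩ Ico 0 (curve y)) +
        (curve ⁻¹' A).indicator (fun y => ENNReal.ofReal (1 - y)) y) := by
  have hcA : MeasurableSet (curve ⁻¹' A) := continuous_curve.measurable hA
  have hBI : MeasurableSet (B ∩ Icc (0 : ℝ) 1) := hB.inter measurableSet_Icc
  have hm : Measurable fun y : ℝ => (curve ⁻¹' A).indicator (fun y => ENNReal.ofReal (1 - y)) y :=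
    Measurable.indicator (by fun_prop) hcA
  have h1 : ((volume.restrict aboveCurve).withDensity
      (fun p => ENNReal.ofReal (Real.exp (p.2 - 1)))) (A ×ˢ B) = ∫⁻ y in B ∩ Icc 0 1,
      ENNReal.ofReal (Real.exp (y - 1)) * volume (A ∩ Ico 0 (curve y)) := by
    have hmS : MeasurableSet (A ×ˢ B ∩ aboveCurve) := (hA.prod hB).inter measurableSet_aboveCurve
    rw [withDensity_apply _ (hA.prod hB), Measure.restrict_restrict (hA.prod hB),
      ← lintegral_indicator hmS, Measure.volume_eq_prod,
      lintegral_prod_symm' _ (Measurable.indicator (by fun_prop) hmS), ← lintegral_indicator hBI]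
    refine lintegral_congr fun y => ?_
    by_cases hy : y ∈ B ∩ Icc 0 1
    · rw [indicator_of_mem hy, ← setLIntegral_const,
        ← lintegral_indicator (hA.inter measurableSet_Ico)]
      refine lintegral_congr fun x => ?_
      by_cases hx : x ∈ A ∩ Ico 0 (curve y)
      · rw [indicator_of_mem hx, indicator_of_mem]
        exact ⟨⟨hx.1, hy.1⟩, mem_aboveCurve.2 ⟨hx.2, hy.2⟩⟩
      · rw [indicator_of_notMem hx, indicator_of_notMem]
        rintro ⟨h1, h2⟩
        exact hx ⟨h1.1, (mem_aboveCurve.1 h2).1⟩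
    · rw [indicator_of_notMem hy]
      refine (lintegral_congr fun x => ?_).trans lintegral_zero
      rw [indicator_of_notMem]
      rintro ⟨h1, h2⟩
      exact hy ⟨h1.2, (mem_aboveCurve.1 h2).2⟩
  have h2 : (((volume.restrict (Icc (0 : ℝ) 1)).withDensity (fun y => ENNReal.ofReal (1 - y))).map
      (fun y : ℝ => (y * Real.exp (1 - y), y))) (A ×ˢ B) = ∫⁻ y in B ∩ Icc 0 1,
      (curve ⁻¹' A).indicator (fun y => ENNReal.ofReal (1 - y)) y := by
    have hpre : (fun y : ℝ => (y * Real.exp (1 - y), y)) ⁻¹' (A ×ˢ B) = curve ⁻¹' A ∩ B := rfl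
    rw [Measure.map_apply (by fun_prop) (hA.prod hB), hpre, withDensity_apply _ (hcA.inter hB),
      Measure.restrict_restrict (hcA.inter hB), setLIntegral_indicator hcA, inter_assoc]
  rw [runsortPermuton, Measure.add_apply, h1, h2, ← lintegral_add_right _ hm]

/-- On each horizontal line the two parts balance: `exp (y - 1) * curve y + (1 - y) = 1`. -/
theorem runsortPermuton_prod_of_Icc_subset {A B : Set ℝ} (hA : MeasurableSet A)
    (hB : MeasurableSet B) (hIA : Icc 0 1 ⊆ A) :
    runsortPermuton (A ×ˢ B) = volume (B ∩ Icc 0 1) := by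
  rw [runsortPermuton_prod hA hB, ← setLIntegral_one]
  refine setLIntegral_congr_fun (hB.inter measurableSet_Icc) fun y hy => ?_
  have hc := curve_mem_Icc hy.2
  rw [indicator_of_mem (show y ∈ curve ⁻¹' A from hIA hc), inter_eq_self_of_subset_right,
    Real.volume_Ico, ← ENNReal.ofReal_mul (Real.exp_nonneg _), ← ENNReal.ofReal_add,
    ← ENNReal.ofReal_one]
  · congr 1
    have : Real.exp (y - 1) * Real.exp (1 - y) = 1 := by
      rw [← Real.exp_add]
      simp
    rw [curve]
    linear_combination y * this
  · exact mul_nonneg (Real.exp_nonneg _) (by linarith [hc.1])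
  · linarith [hy.2.2]
  · exact fun x hx => hIA ⟨hx.1, hx.2.le.trans hc.2⟩

/-- At height `u ≤ s` the box contains the whole slice, of mass density `1`. At height `u > s` the
curve point lies outside and the slice is cut at `curve s`, leaving density `exp (u - 1) * curve s =
s * exp (u - s)`. -/
theorem runsortPermuton_box {s y : ℝ} (hs : s ∈ Icc (0 : ℝ) 1) (hy : y ∈ Icc (0 : ℝ) 1) :
    runsortPermuton (Icc 0 (curve s) ×ˢ Icc 0 y) = ENNReal.ofReal (lowRunDensity s y) := by
  have hlow : ∀ t, t ≤ s → t ≤ y →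
      ∫⁻ u in Icc 0 t, (ENNReal.ofReal (Real.exp (u - 1)) *
        volume (Icc 0 (curve s) ∩ Ico 0 (curve u)) +
        (curve ⁻¹' Icc 0 (curve s)).indicator (fun u => ENNReal.ofReal (1 - u)) u) =
      ENNReal.ofReal t := by
    intro t hts hty
    have : ENNReal.ofReal t = ∫⁻ u in Icc 0 t, 1 := by simp
    rw [this]
    refine setLIntegral_congr_fun measurableSet_Icc fun u hu => ?_
    have hu1 : u ∈ Icc (0 : ℝ) 1 := ⟨hu.1, hu.2.trans (hty.trans hy.2)⟩
    have hc := curve_mem_Icc hu1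
    have hle := curve_strictMonoOn.monotoneOn hu1 hs (hu.2.trans hts)
    rw [indicator_of_mem (show u ∈ curve ⁻¹' Icc 0 (curve s) from ⟨hc.1, hle⟩),
      inter_eq_self_of_subset_right, Real.volume_Ico, ← ENNReal.ofReal_mul (Real.exp_nonneg _),
      ← ENNReal.ofReal_add, ← ENNReal.ofReal_one]
    · congr 1
      have : Real.exp (u - 1) * Real.exp (1 - u) = 1 := by
        rw [← Real.exp_add]
        simp
      rw [curve]
      linear_combination u * this
    · exact mul_nonneg (Real.exp_nonneg _) (by linarith [hc.1])
    · linarith [hu1.2]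
    · exact fun x hx => ⟨hx.1, hx.2.le.trans hle⟩
  rw [runsortPermuton_prod measurableSet_Icc measurableSet_Icc,
    inter_eq_self_of_subset_left (Icc_subset_Icc_right hy.2)]
  rcases le_or_gt y s with h | h
  · rw [lowRunDensity, if_pos h, hlow y h le_rfl]
  · have hhigh : ∫⁻ u in Ioc s y, (ENNReal.ofReal (Real.exp (u - 1)) *
        volume (Icc 0 (curve s) ∩ Ico 0 (curve u)) +
        (curve ⁻¹' Icc 0 (curve s)).indicator (fun u => ENNReal.ofReal (1 - u)) u) =
        ENNReal.ofReal (s * (Real.exp (y - s) - 1)) := by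
      have hint : s * (Real.exp (y - s) - 1) = ∫ u in Ioc s y, s * Real.exp (u - s) := by
        rw [← intervalIntegral.integral_of_le h.le, intervalIntegral.integral_const_mul,
          intervalIntegral.integral_comp_sub_right (fun u => Real.exp u), integral_exp]
        simp
      rw [hint, ofReal_integral_eq_lintegral_ofReal]
      · refine setLIntegral_congr_fun measurableSet_Ioc fun u hu => ?_
        have hu1 : u ∈ Icc (0 : ℝ) 1 := ⟨hs.1.trans hu.1.le, hu.2.trans hy.2⟩
        have hlt := curve_strictMonoOn hs hu1 hu.1
        rw [indicator_of_notMem (fun h : u ∈ curve ⁻¹' Icc 0 (curve s) => not_le.2 hlt h.2),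
          inter_eq_self_of_subset_left (Icc_subset_Ico_right hlt), Real.volume_Icc,
          ← ENNReal.ofReal_mul (Real.exp_nonneg _), add_zero]
        congr 1
        rw [curve, show u - s = (u - 1) + (1 - s) by ring, Real.exp_add]
        ring
      · exact (by fun_prop : Continuous fun u : ℝ => s * Real.exp (u - s)).continuousOn
          |>.integrableOn_Icc.mono_set Ioc_subset_Icc_self
      · exact ae_of_all _ fun u => mul_nonneg hs.1 (Real.exp_nonneg _)
    rw [← Icc_union_Ioc_eq_Icc hs.1 h.le, lintegral_union measurableSet_Ioc, hlow s le_rfl h.le,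
      hhigh, ← ENNReal.ofReal_add hs.1, lowRunDensity, if_neg (not_le.2 h)]
    · congr 1
      ring
    · exact mul_nonneg hs.1 (by simpa using h.le)
    · rw [Set.disjoint_left]
      exact fun x hx hx' => not_lt.2 hx.2 hx'.1

/-- This identifies the limiting length of the initial block of runs with minimum below `s`, and
also yields the first marginal of the limit. -/
theorem lowRunDensity_one {s : ℝ} (hs : s ≤ 1) : lowRunDensity s 1 = curve s := by
  rw [lowRunDensity]
  split_ifs with h
  · rw [le_antisymm hs h, curve_one]
  · rfl

theorem isPermuton_runsortPermuton : IsPermuton runsortPermuton := by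
  have hprob : IsProbabilityMeasure runsortPermuton := by
    refine ⟨?_⟩
    rw [← univ_prod_univ, runsortPermuton_prod_of_Icc_subset .univ .univ (subset_univ _)]
    simp
  refine IsPermuton.of_marginals hprob ?_ ?_
  · have hbox : ∀ x ∈ Icc (0 : ℝ) 1,
        runsortPermuton (Icc 0 x ×ˢ Icc 0 1) = ENNReal.ofReal x := by
      intro x hx
      obtain ⟨s, hs, rfl⟩ := exists_curve_eq hx
      rw [runsortPermuton_box hs (right_mem_Icc.2 zero_le_one), lowRunDensity_one hs.2]
    -- Removing a half-open strip keeps the line at `a`; its mass is found by approximation from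
    -- below, as vertical lines are not yet known to be null.
    have hIco : ∀ x ∈ Icc (0 : ℝ) 1,
        runsortPermuton (Ico 0 x ×ˢ Icc 0 1) = ENNReal.ofReal x := by
      intro x hx
      apply le_antisymm
      · rw [← hbox x hx]
        exact measure_mono (prod_mono Ico_subset_Icc_self le_rfl)
      · rw [ENNReal.ofReal_le_iff_le_toReal (measure_ne_top _ _)]
        refine le_of_forall_lt_imp_le_of_dense fun z hz => ?_
        rcases lt_or_ge z 0 with hz0 | hz0
        · exact hz0.le.trans ENNReal.toReal_nonneg
        · rw [← ENNReal.ofReal_le_iff_le_toReal (measure_ne_top _ _),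
            ← hbox z ⟨hz0, hz.le.trans hx.2⟩]
          exact measure_mono (prod_mono (fun u hu => ⟨hu.1, hu.2.trans_lt hz⟩) le_rfl)
    intro a b ha hab hb
    have h1 : Icc a b ×ˢ Icc (0 : ℝ) 1 = (Icc 0 b ×ˢ Icc 0 1) \ (Ico 0 a ×ˢ Icc 0 1) := by
      ext ⟨x, y⟩
      simp only [mem_prod, Set.mem_sdiff, mem_Icc, mem_Ico]
      constructor
      · rintro ⟨⟨h1, h2⟩, h3⟩
        exact ⟨⟨⟨ha.trans h1, h2⟩, h3⟩, fun h => not_lt.2 h1 h.1.2⟩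
      · rintro ⟨⟨⟨h1, h2⟩, h3⟩, h4⟩
        exact ⟨⟨not_lt.1 fun h => h4 ⟨⟨h1, h⟩, h3⟩, h2⟩, h3⟩
    rw [h1, measure_sdiff (prod_mono ((Ico_subset_Icc_self).trans (Icc_subset_Icc_right hab)) le_rfl)
      (measurableSet_Ico.prod measurableSet_Icc).nullMeasurableSet (measure_ne_top _ _),
      hbox b ⟨ha.trans hab, hb⟩, hIco a ⟨ha, hab.trans hb⟩, ENNReal.ofReal_sub _ ha]
  · intro a b ha _ hb
    rw [runsortPermuton_prod_of_Icc_subset measurableSet_Icc measurableSet_Icc le_rfl,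
      inter_eq_self_of_subset_left (Icc_subset_Icc ha hb), Real.volume_Icc]

theorem boxMass_runsortPermuton {s y : ℝ} (hs : s ∈ Icc (0 : ℝ) 1) (hy : y ∈ Icc (0 : ℝ) 1) :
    boxMass runsortPermuton (curve s) y = lowRunDensity s y := by
  rw [boxMass, measureReal_def, runsortPermuton_box hs hy, ENNReal.toReal_ofReal]
  rw [lowRunDensity]
  split_ifs
  · exact hy.1
  · exact mul_nonneg hs.1 (Real.exp_nonneg _)

theorem runsortPermuton_pos_of_isOpen {U : Set (ℝ × ℝ)} (hU : IsOpen U)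
    (hne : (U ∩ {p | p.1 ∈ Ioo 0 (curve p.2) ∧ p.2 ∈ Ioo (0 : ℝ) 1}).Nonempty) :
    0 < runsortPermuton U := by
  set V : Set (ℝ × ℝ) := U ∩ {p | p.1 ∈ Ioo 0 (curve p.2) ∧ p.2 ∈ Ioo (0 : ℝ) 1} with hV
  have hVo : IsOpen V := by
    refine hU.inter (IsOpen.inter (IsOpen.inter ?_ ?_) (IsOpen.inter ?_ ?_))
    · exact isOpen_lt continuous_const continuous_fst
    · exact isOpen_lt continuous_fst (continuous_curve.comp continuous_snd)
    · exact isOpen_lt continuous_const continuous_snd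
    · exact isOpen_lt continuous_snd continuous_const
  have hVa : V ⊆ aboveCurve := fun p hp =>
    mem_aboveCurve.2 ⟨Ioo_subset_Ico_self hp.2.1, Ioo_subset_Icc_self hp.2.2⟩
  have hvol : 0 < volume V := hVo.measure_pos volume hne
  rw [runsortPermuton, Measure.add_apply]
  refine lt_of_lt_of_le ?_ le_self_add
  rw [withDensity_apply _ hU.measurableSet, Measure.restrict_restrict hU.measurableSet]
  refine (setLIntegral_pos_iff (by fun_prop)).2 (hvol.trans_le (measure_mono fun p hp => ?_))
  refine ⟨?_, hp.1, hVa hp⟩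
  rw [Function.mem_support]
  exact (ENNReal.ofReal_pos.2 (Real.exp_pos _)).ne'

theorem support_runsortPermuton : runsortPermuton.support =
    {p : ℝ × ℝ | p ∈ Icc (0 : ℝ) 1 ×ˢ Icc (0 : ℝ) 1 ∧ p.1 ≤ p.2 * Real.exp (1 - p.2)} := by
  set D : Set (ℝ × ℝ) :=
    {p : ℝ × ℝ | p ∈ Icc (0 : ℝ) 1 ×ˢ Icc (0 : ℝ) 1 ∧ p.1 ≤ p.2 * Real.exp (1 - p.2)} with hD
  have hDc : IsClosed D := (isClosed_Icc.prod isClosed_Icc).inter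
    (isClosed_le continuous_fst (by fun_prop))
  apply Subset.antisymm
  · refine Measure.support_subset_of_isClosed hDc ?_
    rw [mem_ae_iff, runsortPermuton, Measure.add_apply, add_eq_zero]
    constructor
    · refine withDensity_absolutelyContinuous _ _ ?_
      rw [Measure.restrict_apply hDc.measurableSet.compl, ← sdiff_eq_compl_inter, sdiff_eq_empty.2,
        measure_empty]
      exact fun p hp => ⟨hp.1, hp.2.le⟩
    · rw [Measure.map_apply (by fun_prop) hDc.measurableSet.compl]
      refine withDensity_absolutelyContinuous _ _ ?_
      rw [Measure.restrict_apply' measurableSet_Icc]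
      convert measure_empty (μ := (volume : Measure ℝ))
      rw [eq_empty_iff_forall_notMem]
      rintro y ⟨h1, h2⟩
      exact h1 ⟨⟨curve_mem_Icc h2, h2⟩, le_rfl⟩
  · intro p hp
    rw [Measure.support_eq_forall_isOpen]
    intro U hpU hU
    apply runsortPermuton_pos_of_isOpen hU
    -- This map sends the closed square onto the closed region and the open square into its interior
    -- part, so continuity shows that every point of the region is a limit of points where the
    -- density is positive.
    set f : ℝ × ℝ → ℝ × ℝ := fun q => (q.1 * curve q.2, q.2) with hf
    have hfc : Continuous f := by
      have := continuous_curve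
      fun_prop
    have himage : f '' (Ioo 0 1 ×ˢ Ioo 0 1) ⊆
        {p | p.1 ∈ Ioo 0 (curve p.2) ∧ p.2 ∈ Ioo (0 : ℝ) 1} := by
      rintro _ ⟨⟨r, y⟩, ⟨hr, hy⟩, rfl⟩
      have hc : 0 < curve y := mul_pos hy.1 (Real.exp_pos _)
      exact ⟨⟨mul_pos hr.1 hc, mul_lt_of_lt_one_left hc hr.2⟩, hy⟩
    have hpre : p ∈ f '' closure (Ioo 0 1 ×ˢ Ioo 0 1) := by
      rw [closure_prod_eq, closure_Ioo zero_ne_one]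
      obtain ⟨x, y⟩ := p
      have hxy : x ≤ curve y := hp.2
      have hx : x ∈ Icc (0 : ℝ) 1 := hp.1.1
      have hy : y ∈ Icc (0 : ℝ) 1 := hp.1.2
      have hc := (curve_mem_Icc hy).1
      refine ⟨(x / curve y, y), ⟨⟨div_nonneg hx.1 hc, div_le_one_of_le₀ hxy hc⟩, hy⟩, ?_⟩
      rw [hf, Prod.mk.injEq]
      refine ⟨?_, rfl⟩
      -- Where `curve y = 0` the convention `x / 0 = 0` still gives a valid preimage, since then `x
      -- = 0`.
      rcases hc.eq_or_lt with h | h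
      · simp only [← h, mul_zero]
        exact le_antisymm hx.1 (h ▸ hxy)
      · exact div_mul_cancel₀ _ h.ne'
    have hcl := closure_mono himage (image_closure_subset_closure_image hfc hpre)
    exact mem_closure_iff.1 hcl U hU hpU

/-! ### Convergence in mean and in probability. -/

theorem lowRunCount_le_size {n : ℕ} (M Y : ℕ) (π : Equiv.Perm (Fin n)) :
    lowRunCount M Y π ≤ n :=
  (Finset.card_filter_le _ _).trans (by simp)

/-- The box mass is known exactly only at the random abscissa `lowRunCount ⌈s * n⌉₊ n π / n`. This
concentrates at `curve s`, and the Lipschitz bound transfers the value to the deterministic point.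
-/
theorem tendstoInMean_boxMass_runsort {s y : ℝ} (hs : s ∈ Icc (0 : ℝ) 1)
    (hy : y ∈ Icc (0 : ℝ) 1) :
    TendstoInMean (fun _ π => boxMass (permMeasure (runsort π)) (curve s) y)
      (boxMass runsortPermuton (curve s) y) := by
  have h1 := tendstoInMean_lowRunCount hs.1 zero_le_one le_rfl
  have h2 := tendstoInMean_lowRunCount hs.1 hy.1 hy.2
  have h3 := ((tendsto_natCeil_mul_div hy.1).sub_const y).abs
  rw [sub_self, abs_zero] at h3
  simp only [TendstoInMean, one_mul, Nat.ceil_natCast, lowRunDensity_one hs.2] at h1 h2 ⊢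
  rw [boxMass_runsortPermuton hs hy]
  have h := (h1.add h2).add h3
  rw [add_zero, add_zero] at h
  refine squeeze_zero' (Eventually.of_forall fun n => Finset.expect_nonneg fun π _ => abs_nonneg _)
    ?_ h
  filter_upwards [eventually_gt_atTop 0] with n hn
  have hn' : (0 : ℝ) < n := by exact_mod_cast hn
  rw [← Fintype.expect_const (ι := Equiv.Perm (Fin n)) |(⌈y * n⌉₊ : ℝ) / n - y|,
    ← Finset.expect_add_distrib, ← Finset.expect_add_distrib]
  refine Finset.expect_le_expect fun π _ => ?_
  set a := lowRunCount ⌈s * n⌉₊ n π with ha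
  have ha1 : (a / n : ℝ) ∈ Icc (0 : ℝ) 1 := by
    refine ⟨by positivity, (div_le_one hn').2 ?_⟩
    exact_mod_cast lowRunCount_le_size _ _ π
  have hy1 : (⌈y * n⌉₊ / n : ℝ) ∈ Icc (0 : ℝ) 1 := by
    refine ⟨by positivity, (div_le_one hn').2 ?_⟩
    exact_mod_cast natCeil_mul_le hy.2 n
  have hbox := boxMass_permMeasure_div hn (runsort π) a ⌈y * n⌉₊
  rw [ha, card_lt_lowRunCount_and_runsort_lt] at hbox
  have hlip := (isPermuton_permMeasure hn (runsort π)).abs_boxMass_sub_le (curve_mem_Icc hs) ha1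
    hy hy1
  rw [hbox, abs_sub_comm (curve s), abs_sub_comm y] at hlip
  have := abs_sub_le (boxMass (permMeasure (runsort π)) (curve s) y)
    ((lowRunCount ⌈s * n⌉₊ ⌈y * n⌉₊ π : ℝ) / n) (lowRunDensity s y)
  linarith

theorem rectDist_nonneg (γ₁ γ₂ : Measure (ℝ × ℝ)) : 0 ≤ rectDist γ₁ γ₂ := by
  refine Real.sSup_nonneg ?_
  rintro r ⟨x₁, x₂, y₁, y₂, -, -, -, -, -, -, rfl⟩
  exact abs_nonneg _

theorem tendsto_expect_rectDist_runsort :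
    Tendsto (fun n => 𝔼 π : Equiv.Perm (Fin n), rectDist (permMeasure (runsort π)) runsortPermuton)
      atTop (𝓝 0) := by
  rw [tendsto_order]
  refine ⟨fun a ha => Eventually.of_forall fun n => ha.trans_le
    (Finset.expect_nonneg fun π _ => rectDist_nonneg _ _), fun ε hε => ?_⟩
  have hN : Tendsto (fun N : ℕ => 4 * (2 * ((Real.exp 1 + 1) / N))) atTop (𝓝 0) := by
    simpa using ((tendsto_const_div_atTop_nhds_zero_nat (Real.exp 1 + 1)).const_mul 2).const_mul 4
  obtain ⟨N, hNε, hN0⟩ :=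
    ((hN.eventually (gt_mem_nhds (half_pos hε))).and (eventually_gt_atTop 0)).exists
  have hN' : (0 : ℝ) < N := by exact_mod_cast hN0
  have hmem : ∀ j ∈ Finset.range (N + 1), (j / N : ℝ) ∈ Icc (0 : ℝ) 1 := by
    intro j hj
    refine ⟨by positivity, (div_le_one hN').2 ?_⟩
    exact_mod_cast Nat.lt_succ_iff.1 (Finset.mem_range.1 hj)
  have hsum := (tendsto_finsetSum (Finset.range (N + 1)) fun j hj =>
    tendsto_finsetSum (Finset.range (N + 1)) fun l hl =>
      tendstoInMean_boxMass_runsort (hmem j hj) (hmem l hl)).const_mul 4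
  simp only [Finset.sum_const_zero, mul_zero] at hsum
  filter_upwards [hsum.eventually (gt_mem_nhds (half_pos hε)), eventually_gt_atTop 0] with n hn hn0
  simp only [← Finset.expect_sum_comm] at hn
  rw [Finset.mul_expect] at hn
  refine lt_of_le_of_lt ?_ ((add_lt_add hNε hn).trans_eq (add_halves ε))
  rw [← Fintype.expect_const (ι := Equiv.Perm (Fin n)) (4 * (2 * ((Real.exp 1 + 1) / (N : ℝ)))),
    ← Finset.expect_add_distrib]
  refine Finset.expect_le_expect fun π _ => ?_
  rw [← mul_add]
  exact rectDist_le (isPermuton_permMeasure hn0 (runsort π)) isPermuton_runsortPermuton hN0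

theorem uniformOfFintype_toOuterMeasure_eq_ofReal {n : ℕ} (p : Equiv.Perm (Fin n) → Prop)
    [DecidablePred p] :
    (PMF.uniformOfFintype (Equiv.Perm (Fin n))).toOuterMeasure {π | p π} =
      ENNReal.ofReal (𝔼 π, if p π then (1 : ℝ) else 0) := by
  rw [PMF.toOuterMeasure_uniformOfFintype_apply, expect_perm_ite,
    ENNReal.ofReal_div_of_pos (by positivity), ENNReal.ofReal_natCast, ENNReal.ofReal_natCast,
    Fintype.card_perm, Fintype.card_fin]
  congr 2
  exact Fintype.card_subtype p

theorem theorem1p1 :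
    (∀ ε : ℝ, 0 < ε →
      Tendsto
        (fun n : ℕ => (PMF.uniformOfFintype (Equiv.Perm (Fin n))).toOuterMeasure
          {π | rectDist (permMeasure (runsort π)) runsortPermuton < ε})
        atTop (𝓝 1)) ∧
    IsPermuton runsortPermuton ∧
    runsortPermuton.support =
      {p : ℝ × ℝ | p ∈ Icc (0 : ℝ) 1 ×ˢ Icc (0 : ℝ) 1 ∧ p.1 ≤ p.2 * Real.exp (1 - p.2)} := by
  classical
  refine ⟨fun ε hε => ?_, isPermuton_runsortPermuton, support_runsortPermuton⟩
  simp only [uniformOfFintype_toOuterMeasure_eq_ofReal]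
  rw [← ENNReal.ofReal_one]
  refine ENNReal.tendsto_ofReal ?_
  -- Markov's inequality: the probability is at least one minus the mean distance divided by `ε`.
  have hlo := (tendsto_expect_rectDist_runsort.div_const ε).const_sub 1
  rw [zero_div, sub_zero] at hlo
  refine tendsto_of_tendsto_of_tendsto_of_le_of_le hlo tendsto_const_nhds (fun n => ?_) fun n => ?_
  · simp only
    rw [sub_le_iff_le_add', Finset.expect_div, ← Finset.expect_add_distrib]
    refine (Fintype.expect_const (ι := Equiv.Perm (Fin n)) (1 : ℝ)).symm.trans_le
      (Finset.expect_le_expect fun π _ => ?_)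
    have h0 := rectDist_nonneg (permMeasure (runsort π)) runsortPermuton
    split_ifs with h
    · exact le_add_of_nonneg_left (by positivity)
    · rw [add_zero, one_le_div hε]
      exact not_lt.1 h
  · refine le_trans (Finset.expect_le_expect fun π _ => ?_)
      (Fintype.expect_const (ι := Equiv.Perm (Fin n)) (1 : ℝ)).le
    split_ifs <;> simp
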